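/- Let $N=\{1,\dots,n\}$ be a set of items and $\Gamma$ a finite set of states. A partial realization is a vector $b\in(\Gamma\cup\{*\})^n$, where $b_i=*$ means that the state of item $i$ is unknown; $b_{i\leftarrow\gamma}$ is $b$ with $b_i$ replaced by $\gamma$; $b'\succeq b$ means that $b'_i=b_i$ whenever $b_i\ne *$; and $\Delta g(b,i,\gamma)=g(b_{i\leftarrow\gamma})-g(b)$. An instance $(g,Q,S,w,c)$ of Scenario Submodular Cover consists of a function $g:(\Gamma\cup\{*\})^n\to\mathbb Z_{\ge0}$ that is monotone ($g(b)\le g(b_{i\leftarrow\gamma})$ if $b_i=*$) and submodular ($\Delta g(b,i,\gamma)\ge\Delta g(b',i,\gamma)$ if $b'\succeq b$ and $b_i=b'_i=*$), an integer $Q>0$ with $g(a)=Q$ for all $a\in\Gamma^n$, a nonempty sample $S\subseteq\Gamma^n$ with positive integer weights $w(a)$, $a\in S$, and item costs $c_i>0$. A solution is a decision tree whose internal nodes select items, with one child for each state in $\Gamma$, such that no path repeats an item and every root-leaf path ends in a partial realization $b$ with $g(b)=Q$. The cost of a tree on $a\in\Gamma^n$ is the sum of the costs of the items on the path followed by $a$,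 and its expected cost is taken with $\Pr[a]=w(a)/\sum_{a'\in S}w(a')$ for $a\in S$. Let $$\rho=\min\frac{\Delta g(b,i,\gamma)}{Q-g(b)},$$ over all $b$ with $g(b)<Q$, all $i$ with $b_i=*$ and all $\gamma\in\Gamma\setminus\{\gamma_{b,i}\}$, where $\gamma_{b,i}$ is a state minimizing $\Delta g(b,i,\cdot)$ (and $\rho=1$ if there is no such triple). Mixed Greedy is the following recursive algorithm, first called on $b=(*,\dots,*)$; ties are broken arbitrarily. A call on $b$ returns a leaf if $g(b)=Q$. Otherwise let $N'=\{i: b_i=*\}$, choose for each $i\in N'$ a state $\sigma_i$ minimizing $\Delta g(b,i,\cdot)$, and for $U\subseteq N'$ let $g'(U)=g(b_U)-g(b)$, where $b_U$ is $b$ with $b_i$ set to $\sigma_i$ for $i\in U$. Let $\alpha=1-e^{-\chi}$, where $e^\chi=2-\chi$, and let $B$ be the smallest number in $[0,\sum_{i\in N'}c_i]$ such that Wolsey's greedy algorithm with budget $B$, run with a tie-breaking rule that does not depend on the budget, returns a set of value at least $\alpha g'(N')$. (Wolsey's algorithm repeatedly adds to a set $R$, initially empty, a remaining item of cost at most $B$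 maximizing $(g'(R\cup\{i\})-g'(R))/c_i$, until the total cost of $R$ exceeds $B$ or no such item remains; if $i_k$ is the last item, it returns $\{i_k\}$ if $g'(\{i_k\})\ge g'(R\setminus\{i_k\})$ and $R\setminus\{i_k\}$ otherwise. If no item costs at most $B$, it returns $\emptyset$.) Let $I=\{i\in N': c_i\le B\}$, and let $h(R)$ be the total weight of the $a\in S$ with $a\succeq b$ and $a_i\ne\sigma_i$ for some $i\in R$. The algorithm builds a path of nodes in two stages. In the first stage, with $R$ the set of items chosen so far, it selects an $i\in I$ maximizing $(h(R\cup\{i\})-h(R))/c_i$, until the cost spent is at least $B$. In the second stage it selects an $i\in I$ maximizing $\Delta g(b,i,\sigma_i)/c_i$ for the current $b$, until the cost spent in this stage is at least $B$ or $I$ is empty. Whenever an item $i$ is selected, a new node labeled $i$ is appended to the path; for each $\gamma\ne\sigma_i$ its $\gamma$-child is the root of the tree returned by a recursive call on $b_{i\leftarrow\gamma}$, its $\sigma_i$-child is the continuation of the path, $b_i$ is set to $\sigma_i$, and $i$ is removed from $I$. After the second stage the path is continued with the tree returned by a recursive call on the current $b$. Theorem. There is an absolute constant $K>0$ such that on every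 instance of Scenario Submodular Cover Mixed Greedy can be run to completion, every tree $T$ that it outputs is a solution, and, if $\rho>0$ and $\mathrm{OPT}$ is the minimum expected cost of a solution, then the expected cost of $T$ is at most $K\cdot\frac1\rho\log Q\cdot\mathrm{OPT}$ if $Q\ge2$, and at most $K\cdot\mathrm{OPT}$ if $Q=1$. -/

import Mathlib

namespace ScenarioSC

universe u

/-- Partial realizations of `n` items with state set `Γ`; `none` plays the role of `*`. -/
abbrev Partial (n : ℕ) (Γ : Type u) : Type u := Fin n → Option Γ

/-- The partial realization `b_{i ← γ}`. -/
def Partial.set {n : ℕ} {Γ : Type u} (b : Partial n Γ) (i : Fin n) (γ : Γ) : Partial n Γ :=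
  Function.update b i (some γ)

/-- The extension relation `b ⪯ d`. -/
def Partial.ExtendedBy {n : ℕ} {Γ : Type u} (b d : Partial n Γ) : Prop :=
  ∀ i, b i ≠ none → d i = b i

/-- A (full) realization seen as a partial realization. -/
def full {n : ℕ} {Γ : Type u} (a : Fin n → Γ) : Partial n Γ := fun i => some (a i)

/-- `Δg(b, i, γ) = g(b_{i ← γ}) - g(b)`. -/
def gain {n : ℕ} {Γ : Type u} (g : Partial n Γ → ℕ) (b : Partial n Γ) (i : Fin n) (γ : Γ) : ℝ :=
  (g (b.set i γ) : ℝ) - (g b : ℝ)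

/-- Monotonicity of a state-dependent utility function. -/
def IsMonotone {n : ℕ} {Γ : Type u} (g : Partial n Γ → ℕ) : Prop :=
  ∀ (b : Partial n Γ) (i : Fin n) (γ : Γ), b i = none → g b ≤ g (b.set i γ)

/-- Submodularity of a state-dependent utility function. -/
def IsSubmodular {n : ℕ} {Γ : Type u} (g : Partial n Γ → ℕ) : Prop :=
  ∀ (b d : Partial n Γ) (i : Fin n) (γ : Γ), b.ExtendedBy d → b i = none → d i = none →
    gain g d i γ ≤ gain g b i γ

/-- `g` has goal value `Q`: it takes the value `Q` on every realization. -/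
def HasGoalValue {n : ℕ} {Γ : Type u} (g : Partial n Γ → ℕ) (Q : ℕ) : Prop :=
  ∀ a : Fin n → Γ, g (full a) = Q

/-- An instance `(g, Q, S, w, c)` of the Scenario Submodular Cover problem. -/
structure Problem (n : ℕ) (Γ : Type u) where
  /-- the utility function -/
  g : Partial n Γ → ℕ
  /-- the goal value -/
  Q : ℕ
  /-- the sample -/
  S : Finset (Fin n → Γ)
  /-- the weights (only the values on the sample matter) -/
  w : (Fin n → Γ) → ℕ
  /-- the costs of the items -/
  c : Fin n → ℝ
  g_monotone : IsMonotone g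
  g_submodular : IsSubmodular g
  g_goal : HasGoalValue g Q
  Q_pos : 0 < Q
  S_nonempty : S.Nonempty
  w_pos : ∀ a ∈ S, 0 < w a
  c_pos : ∀ i, 0 < c i

/-- Decision trees: internal nodes are labeled with items and have one child per state. -/
inductive DTree (n : ℕ) (Γ : Type u) : Type u
  | leaf : DTree n Γ
  | node (item : Fin n) (child : Γ → DTree n Γ) : DTree n Γ

/-- `κ(τ, a)`: the total cost of the items on the path that realization `a` follows in `τ`. -/
def DTree.pathCost {n : ℕ} {Γ : Type u} (c : Fin n → ℝ) : DTree n Γ → (Fin n → Γ) → ℝ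
  | .leaf, _ => 0
  | .node i child, a => c i + (child (a i)).pathCost c a

/-- `τ.SolvesFrom g Q b`: started from `b`, the strategy `τ` never selects an item whose state is
already known, and every root-leaf path ends in a partial realization of utility `Q`. -/
def DTree.SolvesFrom {n : ℕ} {Γ : Type u} (g : Partial n Γ → ℕ) (Q : ℕ) :
    DTree n Γ → Partial n Γ → Prop
  | .leaf, b => g b = Q
  | .node i child, b => b i = none ∧ ∀ γ, (child γ).SolvesFrom g Q (b.set i γ)

/-- The empty partial realization `(*, …, *)`. -/
def emptyPartial (n : ℕ) (Γ : Type u) : Partial n Γ := fun _ => none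

/-- `1 - e^{-χ}` needs a solution of `e^χ = 2 - χ`; it exists (and is unique, as `exp χ + χ` is
strictly increasing). -/
theorem exists_chi : ∃ χ : ℝ, Real.exp χ = 2 - χ := by
  have hc : ContinuousOn (fun x : ℝ => Real.exp x + x) (Set.Icc 0 1) := by fun_prop
  have h := intermediate_value_Icc (zero_le_one' ℝ) hc
  have h2 : (2 : ℝ) ∈ Set.Icc (Real.exp 0 + 0) (Real.exp 1 + 1) := by
    have := Real.add_one_le_exp (1 : ℝ)
    constructor
    · norm_num
    · linarith
  obtain ⟨x, -, hx⟩ := h h2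
  exact ⟨x, by simp only at hx; linarith⟩

/-- The solution `χ` of `e^χ = 2 - χ`. -/
noncomputable def chi : ℝ := Classical.choose exists_chi

/-- The constant `α = 1 - e^{-χ} ≈ 0.35`. -/
noncomputable def alpha : ℝ := 1 - Real.exp (-chi)

/-- `i` is an item of `E` maximizing `(f(R ∪ {i}) - f(R)) / c_i` among the items of `E`. -/
def IsGreedyChoice {n : ℕ} (f : Finset (Fin n) → ℝ) (c : Fin n → ℝ) (R E : Finset (Fin n))
    (i : Fin n) : Prop :=
  i ∈ E ∧ ∀ j ∈ E, (f (insert j R) - f R) / c j ≤ (f (insert i R) - f R) / c i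

/-- A rule for breaking ties: it picks an item from every nonempty set of items. -/
structure TieRule (n : ℕ) where
  pick : Finset (Fin n) → Fin n
  pick_mem : ∀ A : Finset (Fin n), A.Nonempty → pick A ∈ A

open Classical in
/-- The item that the greedy rule picks from `E`, given that `R` has been chosen. -/
noncomputable def greedyPick {n : ℕ} (tie : TieRule n) (f : Finset (Fin n) → ℝ) (c : Fin n → ℝ)
    (R E : Finset (Fin n)) : Fin n :=
  tie.pick (E.filter (IsGreedyChoice f c R E))

theorem greedyPick_mem {n : ℕ} (tie : TieRule n) (f : Finset (Fin n) → ℝ) (c : Fin n → ℝ)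
    (R E : Finset (Fin n)) (hE : E.Nonempty) : greedyPick tie f c R E ∈ E := by
  classical
  obtain ⟨i, hi, hmax⟩ := E.exists_max_image (fun j => (f (insert j R) - f R) / c j) hE
  have hne : (E.filter (IsGreedyChoice f c R E)).Nonempty :=
    ⟨i, Finset.mem_filter.2 ⟨hi, hi, hmax⟩⟩
  exact (Finset.mem_filter.1 (tie.pick_mem _ hne)).1

open Classical in
/-- The loop of Wolsey's greedy algorithm with budget `B`: `E` is the set of remaining items of
cost at most `B`, and `R` the set of items chosen so far. The loop stops as soon as the money spent
exceeds `B` or no item is left; then the better of the last item alone and the set of the other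
chosen items is returned. -/
noncomputable def wolseyLoop {n : ℕ} (tie : TieRule n) (f : Finset (Fin n) → ℝ) (c : Fin n → ℝ)
    (B : ℝ) (E R : Finset (Fin n)) : Finset (Fin n) :=
  if hE : E.Nonempty then
    let i := greedyPick tie f c R E
    if B < (∑ j ∈ R, c j) + c i ∨ E.erase i = ∅ then
      if f R ≤ f {i} then {i} else R
    else
      wolseyLoop tie f c B (E.erase i) (insert i R)
  else R
termination_by E.card
decreasing_by exact Finset.card_erase_lt_of_mem (greedyPick_mem tie f c R E hE)

open Classical in
/-- Wolsey's greedy algorithm for maximizing `f` over the subsets of `N` of cost at most `B`. -/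
noncomputable def wolseyGreedy {n : ℕ} (tie : TieRule n) (N : Finset (Fin n))
    (f : Finset (Fin n) → ℝ) (c : Fin n → ℝ) (B : ℝ) : Finset (Fin n) :=
  wolseyLoop tie f c B (N.filter (fun i => c i ≤ B)) ∅

/-- `B` is a result of `FindBudget(N, f, c)`: the smallest `B ∈ [0, ∑_{i ∈ N} c_i]` such that
Wolsey's greedy algorithm with budget `B` returns a set of value at least `α f(N)`. The rule by
which Wolsey's algorithm breaks ties is arbitrary. -/
def IsFindBudget {n : ℕ} (N : Finset (Fin n)) (f : Finset (Fin n) → ℝ) (c : Fin n → ℝ)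
    (B : ℝ) : Prop :=
  ∃ tie : TieRule n,
    IsLeast {x : ℝ | 0 ≤ x ∧ x ≤ ∑ i ∈ N, c i ∧ alpha * f N ≤ f (wolseyGreedy tie N f c x)} B

/-- `γ` is a worst-case state of item `i` at `b`: it minimizes `Δg(b, i, ·)`. -/
def IsWorstState {n : ℕ} {Γ : Type u} (g : Partial n Γ → ℕ) (b : Partial n Γ) (i : Fin n)
    (γ : Γ) : Prop :=
  ∀ γ', gain g b i γ ≤ gain g b i γ'

namespace Problem

variable {n : ℕ} {Γ : Type u}

/-- A decision tree is a solution if it achieves goal value `Q` on all realizations. -/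
def IsSolution (P : Problem n Γ) (τ : DTree n Γ) : Prop :=
  τ.SolvesFrom P.g P.Q (emptyPartial n Γ)

/-- The total weight `W` of the sample. -/
def totalWeight (P : Problem n Γ) : ℕ := ∑ a ∈ P.S, P.w a

/-- The expected cost of a decision tree under the sample distribution `Pr[a] = w(a) / W`. -/
noncomputable def expectedCost (P : Problem n Γ) (τ : DTree n Γ) : ℝ :=
  ∑ a ∈ P.S, (P.w a : ℝ) / (P.totalWeight : ℝ) * τ.pathCost P.c a

/-- The fractions `Δg(b, i, γ) / (Q - g(b))`, over all `b` with `g(b) < Q`, all items `i` with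
`b_i = *` and all states `γ` other than the worst-case state `γ_{b,i}`. All ways of choosing
`γ_{b,i}` among the minimizers are admitted, which does not affect the minimum. -/
def nextToWorstFractions (P : Problem n Γ) : Set ℝ :=
  {x | ∃ (b : Partial n Γ) (i : Fin n) (worst γ : Γ), P.g b < P.Q ∧ b i = none ∧
    IsWorstState P.g b i worst ∧ γ ≠ worst ∧
    x = gain P.g b i γ / ((P.Q : ℝ) - (P.g b : ℝ))}

open Classical in
/-- The parameter `ρ`. None of the fractions exceeds `1`; if there are none (as for a single
state), then `ρ = 1`. -/
noncomputable def rho (P : Problem n Γ) : ℝ :=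
  if P.nextToWorstFractions.Nonempty then sInf P.nextToWorstFractions else 1

open Classical in
/-- The set of items whose state is unknown in `b`. -/
noncomputable def unknown (b : Partial n Γ) : Finset (Fin n) :=
  Finset.univ.filter (fun i => b i = none)

/-- The extension `b_U` of `b` that gives the items of `U` the states prescribed by `σ`. -/
def extendBy (b : Partial n Γ) (σ : Fin n → Γ) (U : Finset (Fin n)) : Partial n Γ :=
  fun i => if i ∈ U then some (σ i) else b i

/-- `U ↦ g(b_U) - g(b)`. -/
def utilityAlong (P : Problem n Γ) (b : Partial n Γ) (σ : Fin n → Γ) (U : Finset (Fin n)) : ℝ :=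
  (P.g (extendBy b σ U) : ℝ) - (P.g b : ℝ)

open Classical in
/-- `h(R)`: the weight of the sample elements `a ⪰ b` with `a_i ≠ σ_i` for some `i ∈ R`. -/
noncomputable def removedWeight (P : Problem n Γ) (b : Partial n Γ) (σ : Fin n → Γ)
    (R : Finset (Fin n)) : ℝ :=
  ∑ a ∈ P.S.filter (fun a => b.ExtendedBy (full a) ∧ ∃ i ∈ R, a i ≠ σ i), (P.w a : ℝ)

end Problem

/-- The control states of Mixed Greedy. `call b` is a recursive call on `b`. `first b₀ σ B b R I s`
and `second σ B b I s` are the heads of the first and the second loop: `b₀` is the partial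
realization of the current call, `b` its present extension along the backbone, `B` the budget, `R`
the set of items chosen in the first loop, `I` the set of items still available, and `s` the
money spent in the loop. -/
inductive Control (n : ℕ) (Γ : Type u) : Type u
  | call (b : Partial n Γ) : Control n Γ
  | first (b₀ : Partial n Γ) (σ : Fin n → Γ) (B : ℝ) (b : Partial n Γ)
      (R I : Finset (Fin n)) (spent : ℝ) : Control n Γ
  | second (σ : Fin n → Γ) (B : ℝ) (b : Partial n Γ) (I : Finset (Fin n)) (spent : ℝ) :
      Control n Γ

open Classical in
/-- `P.Builds s T`: a run of Mixed Greedy from the control state `s` terminates and constructs the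
subtree `T`. Every choice of a minimizing state or of a maximizing item is arbitrary.
The budget is positive whenever it is computed, so testing the exit conditions at the head of the
loops is the same as testing them after each iteration, except that the second loop is skipped if
the first one has used up all available items. -/
inductive Problem.Builds {n : ℕ} {Γ : Type u} (P : Problem n Γ) :
    Control n Γ → DTree n Γ → Prop
  /-- a call on a partial realization that has reached the goal value -/
  | done (b : Partial n Γ) (hb : P.g b = P.Q) : Builds P (.call b) .leaf
  /-- any other call: compute `σ` and the budget, and enter the first loop -/
  | start (b : Partial n Γ) (σ : Fin n → Γ) (B : ℝ) (T : DTree n Γ)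
      (hb : P.g b ≠ P.Q)
      (hσ : ∀ i, b i = none → IsWorstState P.g b i (σ i))
      (hB : IsFindBudget (Problem.unknown b) (P.utilityAlong b σ) P.c B)
      (hT : Builds P
        (.first b σ B b ∅ ((Problem.unknown b).filter (fun i => P.c i ≤ B)) 0) T) :
      Builds P (.call b) T
  /-- an iteration of the first loop -/
  | firstStep (b₀ : Partial n Γ) (σ : Fin n → Γ) (B : ℝ) (b : Partial n Γ)
      (R I : Finset (Fin n)) (spent : ℝ) (i : Fin n) (child : Γ → DTree n Γ)
      (hs : spent < B)
      (hi : IsGreedyChoice (P.removedWeight b₀ σ) P.c R I i)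
      (hrec : ∀ γ, γ ≠ σ i → Builds P (.call (b.set i γ)) (child γ))
      (hnext : Builds P
        (.first b₀ σ B (b.set i (σ i)) (insert i R) (I.erase i) (spent + P.c i)) (child (σ i))) :
      Builds P (.first b₀ σ B b R I spent) (.node i child)
  /-- the end of the first loop -/
  | firstExit (b₀ : Partial n Γ) (σ : Fin n → Γ) (B : ℝ) (b : Partial n Γ)
      (R I : Finset (Fin n)) (spent : ℝ) (T : DTree n Γ)
      (hs : B ≤ spent)
      (hT : Builds P (.second σ B b I 0) T) :
      Builds P (.first b₀ σ B b R I spent) T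
  /-- an iteration of the second loop -/
  | secondStep (σ : Fin n → Γ) (B : ℝ) (b : Partial n Γ) (I : Finset (Fin n)) (spent : ℝ)
      (i : Fin n) (child : Γ → DTree n Γ)
      (hs : spent < B)
      (hi : i ∈ I)
      (hmax : ∀ j ∈ I, gain P.g b j (σ j) / P.c j ≤ gain P.g b i (σ i) / P.c i)
      (hrec : ∀ γ, γ ≠ σ i → Builds P (.call (b.set i γ)) (child γ))
      (hnext : Builds P
        (.second σ B (b.set i (σ i)) (I.erase i) (spent + P.c i)) (child (σ i))) :
      Builds P (.second σ B b I spent) (.node i child)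
  /-- the end of the second loop, followed by the last recursive call -/
  | secondExit (σ : Fin n → Γ) (B : ℝ) (b : Partial n Γ) (I : Finset (Fin n)) (spent : ℝ)
      (T : DTree n Γ)
      (hs : B ≤ spent ∨ I = ∅)
      (hT : Builds P (.call b) T) :
      Builds P (.second σ B b I spent) T

/-- `T` is an output of Mixed Greedy on the instance `P`. -/
def Problem.IsMixedGreedyTree {n : ℕ} {Γ : Type u} (P : Problem n Γ) (T : DTree n Γ) : Prop :=
  P.Builds (.call (emptyPartial n Γ)) T

end ScenarioSC

/-! Fix a solution `τ` and write κ(a) for its cost on a. The output is compared with `τ` itself at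
every recursive call, over the sample elements compatible with that call (`mass`); no induced
instance is needed. By induction on the run (`Builds.costBound`), the backbone of a call on b₀ costs
at most 44 times the mass of κ over a ⪰ b₀. The calls made from one backbone concern disjoint parts
of the sample, so each level of recursion costs at most 44 times `τ`.

Each call shrinks Q - g by a factor 1 - ρα/2. Off the backbone this is the definition of ρ
(`progress_off`). At its end, the second loop has secured half of what budget B can buy, and the
budget was computed so that it can buy α(Q - g(b₀)) (`progress_end`). As g is integral, 1 + log Q /
(ρα/2) levels suffice.

The backbone is bounded as in min-sum set cover. Given four times the cost of a set of full value,
Wolsey's algorithm reaches 2/5 ≥ α of that value, so B ≤ 4κ on the completion of b₀ by worst-case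
states (`budget_le`). Let y be the weight still on the backbone in the first loop, and let t be such
that weight at most y/2 has κ > t. If t < B/4, the items that `τ` tests on the completion within
cost t separate from it every element with κ ≤ t, so the greedy item removes weight at rate at least
(y/2)/t (`removed_ge`). The node is paid for by the drop of the potential min over x of (y/2)x + ∑
w(a)(κ(a) - x)⁺, whose minimizer is such a t (`exists_threshold`). If weight at least y/2 has κ ≥
B/4, all that is left of the backbone, at most 4By, is paid for at once. The second loop costs at
most 2By and is charged to the first, which has spent s ≥ B; this is the term 2sy in `CostBound`. -/

namespace ScenarioSC

/-! ### Submodular set functions, Wolsey's greedy algorithm and the budget. -/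

section SetFunctions

variable {n : ℕ}

/-- A set function is monotone and submodular on the subsets of `N`. -/
structure SubmodularOn (N : Finset (Fin n)) (f : Finset (Fin n) → ℝ) : Prop where
  mono : ∀ R ⊆ N, ∀ i ∈ N, f R ≤ f (insert i R)
  diminishing : ∀ R R' : Finset (Fin n), R ⊆ R' → R' ⊆ N → ∀ i ∈ N,
    f (insert i R') - f R' ≤ f (insert i R) - f R

variable {N : Finset (Fin n)} {f : Finset (Fin n) → ℝ} {c : Fin n → ℝ}

theorem SubmodularOn.le_union (hf : SubmodularOn N f) {R V : Finset (Fin n)} (hR : R ⊆ N)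
    (hV : V ⊆ N) : f R ≤ f (V ∪ R) := by
  induction V using Finset.induction_on with
  | empty => simp
  | insert i V hi ih =>
    rw [Finset.insert_subset_iff] at hV
    rw [Finset.insert_union]
    exact (ih hV.2).trans (hf.mono _ (Finset.union_subset hV.2 hR) _ hV.1)

theorem SubmodularOn.le_of_subset (hf : SubmodularOn N f) {R V : Finset (Fin n)} (hRV : R ⊆ V)
    (hV : V ⊆ N) : f R ≤ f V := by
  have := hf.le_union (hRV.trans hV) hV
  rwa [Finset.union_eq_left.2 hRV] at this

theorem SubmodularOn.union_sub_le (hf : SubmodularOn N f) {R V : Finset (Fin n)} (hR : R ⊆ N)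
    (hV : V ⊆ N) : f (V ∪ R) - f R ≤ ∑ j ∈ V, (f (insert j R) - f R) := by
  induction V using Finset.induction_on with
  | empty => simp
  | insert i V hi ih =>
    rw [Finset.insert_subset_iff] at hV
    rw [Finset.insert_union, Finset.sum_insert hi]
    have h1 := ih hV.2
    have h2 := hf.diminishing R (V ∪ R) Finset.subset_union_right
      (Finset.union_subset hV.2 hR) i hV.1
    linarith

/-- The gain of a greedy choice, compared with any set `V` of available items. -/
theorem SubmodularOn.greedy_gain (hf : SubmodularOn N f) (hc : ∀ i, 0 < c i)
    {R E V : Finset (Fin n)} {i : Fin n} (hRN : R ⊆ N) (hEN : E ⊆ N) (hV : V ⊆ R ∪ E)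
    (hi : IsGreedyChoice f c R E i) :
    c i * (f V - f R) ≤ (∑ j ∈ V, c j) * (f (insert i R) - f R) := by
  have hVN : V ⊆ N := hV.trans (Finset.union_subset hRN hEN)
  have h1 : f V ≤ f (V ∪ R) :=
    hf.le_of_subset Finset.subset_union_left (Finset.union_subset hVN hRN)
  have h2 := hf.union_sub_le hRN hVN
  calc c i * (f V - f R) ≤ c i * ∑ j ∈ V, (f (insert j R) - f R) :=
        mul_le_mul_of_nonneg_left (by linarith) (hc i).le
    _ = ∑ j ∈ V, c i * (f (insert j R) - f R) := Finset.mul_sum _ _ _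
    _ ≤ ∑ j ∈ V, c j * (f (insert i R) - f R) := by
        refine Finset.sum_le_sum fun j hj => ?_
        by_cases hjR : j ∈ R
        · rw [Finset.insert_eq_of_mem hjR, sub_self, mul_zero]
          have := hf.mono R hRN i (hEN hi.1)
          exact mul_nonneg (hc j).le (by linarith)
        · have hjE : j ∈ E := (Finset.mem_union.1 (hV hj)).resolve_left hjR
          have := hi.2 j hjE
          rw [div_le_div_iff₀ (hc j) (hc i)] at this
          linarith
    _ = _ := by rw [Finset.sum_mul]

theorem greedyPick_isGreedyChoice (tie : TieRule n) (f : Finset (Fin n) → ℝ) (c : Fin n → ℝ)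
    (R E : Finset (Fin n)) (hE : E.Nonempty) :
    IsGreedyChoice f c R E (greedyPick tie f c R E) := by
  classical
  obtain ⟨i, hi, hmax⟩ := E.exists_max_image (fun j => (f (insert j R) - f R) / c j) hE
  have hne : (E.filter (IsGreedyChoice f c R E)).Nonempty :=
    ⟨i, Finset.mem_filter.2 ⟨hi, hi, hmax⟩⟩
  have := (Finset.mem_filter.1 (tie.pick_mem _ hne)).2
  unfold greedyPick
  convert this

/-- Whatever stops Wolsey's loop, it returns a set of at least half the value of all chosen items,
and these are worth `4/5` of any set `V` whose cost is at most a quarter of the budget. -/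
theorem le_wolseyLoop (hf : SubmodularOn N f) (hf0 : f ∅ = 0) (hc : ∀ i, 0 < c i)
    (tie : TieRule n) {B L : ℝ} {V : Finset (Fin n)} (hL : 0 < L) (hVL : ∑ j ∈ V, c j ≤ L)
    (k : ℕ) : ∀ (E R : Finset (Fin n)), E.card = k → R ⊆ N → E ⊆ N → V ⊆ R ∪ E →
      Disjoint R E → (4 * L ≤ B ∨ ∑ j ∈ R, c j + ∑ j ∈ E, c j ≤ B) →
      min (4 * L) (∑ j ∈ R, c j) * f V ≤ 5 * L * f R →
      2 / 5 * f V ≤ f (wolseyLoop tie f c B E R) := by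
  induction k with
  | zero =>
    intro E R hk hR hE hV _ _ _
    rw [Finset.card_eq_zero] at hk
    subst hk
    rw [wolseyLoop]
    simp only [Finset.not_nonempty_empty, dite_false]
    rw [Finset.union_empty] at hV
    have h1 := hf.le_of_subset hV hR
    have h2 := hf.le_of_subset (Finset.empty_subset V) (hV.trans hR)
    linarith
  | succ k ih =>
    intro E R hk hR hE hV hdis hB hinv
    have hEne : E.Nonempty := by
      rw [← Finset.card_pos]; omega
    have hg := greedyPick_isGreedyChoice tie f c R E hEne
    rw [wolseyLoop]
    simp only [hEne, dite_true]
    generalize greedyPick tie f c R E = i at hg ⊢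
    have hiE := hg.1
    have hiN := hE hiE
    have hiR : i ∉ R := fun h => Finset.disjoint_left.1 hdis h hiE
    have hVN : V ⊆ N := hV.trans (Finset.union_subset hR hE)
    have hfV : 0 ≤ f V := hf0 ▸ hf.le_of_subset (Finset.empty_subset V) hVN
    have hgain := hf.greedy_gain hc hR hE hV hg
    have hm := hf.mono R hR i hiN
    -- As long as R is worth less than 4/5 of V, every unit of cost gains at least f(V)/(5L); after
    -- that the bound 4L in the minimum takes over.
    have hinv' : min (4 * L) (∑ j ∈ insert i R, c j) * f V ≤ 5 * L * f (insert i R) := by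
      rw [Finset.sum_insert hiR]
      by_cases h5 : 4 * f V ≤ 5 * f R
      · calc _ ≤ 4 * L * f V := mul_le_mul_of_nonneg_right (min_le_left _ _) hfV
          _ = L * (4 * f V) := by ring
          _ ≤ L * (5 * f (insert i R)) := mul_le_mul_of_nonneg_left (by linarith) hL.le
          _ = _ := by ring
      · push Not at h5
        have h6 : (∑ j ∈ V, c j) * (f (insert i R) - f R) ≤ L * (f (insert i R) - f R) :=
          mul_le_mul_of_nonneg_right hVL (by linarith)
        have h7 : c i * (f V / 5) ≤ c i * (f V - f R) :=
          mul_le_mul_of_nonneg_left (by linarith) (hc i).le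
        have h8 : min (4 * L) (c i + ∑ j ∈ R, c j) ≤ c i + min (4 * L) (∑ j ∈ R, c j) := by
          have := (hc i).le
          rcases le_total (4 * L) (∑ j ∈ R, c j) with h | h
          · rw [min_eq_left h]; exact (min_le_left _ _).trans (by linarith)
          · rw [min_eq_right h]; exact min_le_right _ _
        have h9 := mul_le_mul_of_nonneg_right h8 hfV
        linarith
    have hunion : insert i R ∪ E.erase i = R ∪ E := by
      ext j; simp only [Finset.mem_union, Finset.mem_insert, Finset.mem_erase]
      by_cases hj : j = i
      · subst hj; simp [hiE]
      · simp [hj]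
    have hinsN : insert i R ⊆ N := Finset.insert_subset hiN hR
    by_cases hfin : B < ∑ j ∈ R, c j + c i ∨ E.erase i = ∅
    · rw [if_pos hfin]
      -- By subadditivity the better of {i} and R is worth at least half of their union, which turns
      -- 4/5 into 2/5.
      have hsub : f (insert i R) - f R ≤ f {i} := by
        have := hf.diminishing ∅ R (Finset.empty_subset _) hR i hiN
        simpa [hf0] using this
      have key : 4 * f V ≤ 5 * f (insert i R) := by
        by_cases hemp : E.erase i = ∅
        · have : V ⊆ insert i R := by
            rw [← hunion, hemp, Finset.union_empty] at hV; exact hV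
          have := hf.le_of_subset this hinsN
          linarith
        · have hlt : B < ∑ j ∈ R, c j + c i := hfin.resolve_right hemp
          -- The budget can only be exceeded if it cannot pay for all items, so the first
          -- alternative of `hB` holds and the cost of the chosen items has passed 4L.
          have h4 : 4 * L ≤ B := by
            refine hB.resolve_right fun h => ?_
            have := Finset.single_le_sum (f := c) (fun j _ => (hc j).le) hiE
            linarith
          rw [Finset.sum_insert hiR, min_eq_left (by linarith)] at hinv'
          have : L * (4 * f V) ≤ L * (5 * f (insert i R)) := by linarith
          exact le_of_mul_le_mul_left this hL
      split_ifs with hlast <;> linarith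
    · rw [if_neg hfin]
      refine ih _ _ ?_ hinsN ((Finset.erase_subset _ _).trans hE) (hunion ▸ hV) ?_ ?_ hinv'
      · rw [Finset.card_erase_of_mem hiE]; omega
      · rw [Finset.disjoint_insert_left]
        exact ⟨Finset.notMem_erase _ _, hdis.mono_right (Finset.erase_subset _ _)⟩
      · refine hB.imp_right fun h => ?_
        rw [Finset.sum_insert hiR]
        have := Finset.sum_erase_add E c hiE
        linarith

theorem le_wolseyGreedy (hf : SubmodularOn N f) (hf0 : f ∅ = 0) (hc : ∀ i, 0 < c i)
    (tie : TieRule n) {B L : ℝ} {V : Finset (Fin n)} (hVN : V ⊆ N) (hL : 0 < L)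
    (hVL : ∑ j ∈ V, c j ≤ L) (hLB : L ≤ B) (hB : 4 * L ≤ B ∨ ∑ j ∈ N, c j ≤ B) :
    2 / 5 * f V ≤ f (wolseyGreedy tie N f c B) := by
  classical
  refine le_wolseyLoop hf hf0 hc tie hL hVL _ _ _ rfl (Finset.empty_subset _) ?_ ?_
    (Finset.disjoint_empty_left _) ?_ ?_
  · exact Finset.filter_subset _ _
  · intro j hj
    have := Finset.single_le_sum (f := c) (fun j _ => (hc j).le) hj
    simp only [Finset.empty_union, Finset.mem_filter]
    exact ⟨hVN hj, by linarith⟩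
  · refine hB.imp_right fun h => ?_
    have := Finset.sum_le_sum_of_subset_of_nonneg (Finset.filter_subset (fun i => c i ≤ B) N)
      (fun j _ _ => (hc j).le)
    simp only [Finset.sum_empty, zero_add]
    linarith
  · simp [hf0, hL.le]

theorem wolseyLoop_subset (tie : TieRule n) (f : Finset (Fin n) → ℝ) {B : ℝ} (k : ℕ) :
    ∀ (E R : Finset (Fin n)), E.card = k → (∀ i ∈ E, c i ≤ B) → Disjoint R E →
      ∑ j ∈ R, c j ≤ B →
      wolseyLoop tie f c B E R ⊆ R ∪ E ∧ ∑ j ∈ wolseyLoop tie f c B E R, c j ≤ B := by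
  induction k with
  | zero =>
    intro E R hk _ _ hR
    rw [Finset.card_eq_zero] at hk
    subst hk
    rw [wolseyLoop]
    simp [hR]
  | succ k ih =>
    intro E R hk hE hdis hR
    have hEne : E.Nonempty := by
      rw [← Finset.card_pos]; omega
    have hiE := greedyPick_mem tie f c R E hEne
    rw [wolseyLoop]
    simp only [hEne, dite_true]
    generalize greedyPick tie f c R E = i at hiE ⊢
    have hiR : i ∉ R := fun h => Finset.disjoint_left.1 hdis h hiE
    split_ifs with hfin hlast
    · simp [hiE, hE i hiE]
    · exact ⟨Finset.subset_union_left, hR⟩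
    · push Not at hfin
      obtain ⟨h1, h2⟩ := ih (E.erase i) (insert i R)
        (by rw [Finset.card_erase_of_mem hiE]; omega)
        (fun j hj => hE j (Finset.mem_of_mem_erase hj))
        (by
          rw [Finset.disjoint_insert_left]
          exact ⟨Finset.notMem_erase _ _, hdis.mono_right (Finset.erase_subset _ _)⟩)
        (by rw [Finset.sum_insert hiR]; linarith [hfin.1])
      refine ⟨h1.trans ?_, h2⟩
      intro j
      simp only [Finset.mem_union, Finset.mem_insert, Finset.mem_erase]
      rintro ((rfl | h) | h)
      · exact Or.inr hiE
      · exact Or.inl h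
      · exact Or.inr h.2

theorem wolseyGreedy_subset (tie : TieRule n) (f : Finset (Fin n) → ℝ) {B : ℝ} (hB : 0 ≤ B) :
    wolseyGreedy tie N f c B ⊆ N.filter (fun i => c i ≤ B) ∧
      ∑ j ∈ wolseyGreedy tie N f c B, c j ≤ B := by
  classical
  have := wolseyLoop_subset (c := c) tie f (B := B) _ (N.filter (fun i => c i ≤ B)) ∅ rfl
    (fun i hi => (Finset.mem_filter.1 hi).2) (Finset.disjoint_empty_left _) (by simpa using hB)
  rw [Finset.empty_union] at this
  unfold wolseyGreedy
  convert this

/-- Wolsey's loop depends on the budget only through comparisons with costs of sets. -/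
theorem wolseyLoop_congr (tie : TieRule n) (f : Finset (Fin n) → ℝ) {x y : ℝ}
    (hxy : ∀ U ⊆ N, x < ∑ j ∈ U, c j ↔ y < ∑ j ∈ U, c j) (k : ℕ) :
    ∀ (E R : Finset (Fin n)), E.card = k → R ⊆ N → E ⊆ N → Disjoint R E →
      wolseyLoop tie f c x E R = wolseyLoop tie f c y E R := by
  induction k with
  | zero =>
    intro E R hk _ _ _
    rw [Finset.card_eq_zero] at hk
    subst hk
    rw [wolseyLoop, wolseyLoop]
    simp
  | succ k ih =>
    intro E R hk hR hE hdis
    have hEne : E.Nonempty := by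
      rw [← Finset.card_pos]; omega
    have hiE := greedyPick_mem tie f c R E hEne
    rw [wolseyLoop, wolseyLoop]
    simp only [hEne, dite_true]
    generalize greedyPick tie f c R E = i at hiE ⊢
    have hiR : i ∉ R := fun h => Finset.disjoint_left.1 hdis h hiE
    have hins := Finset.insert_subset (hE hiE) hR
    have h1 := hxy _ hins
    rw [Finset.sum_insert hiR, add_comm (c i)] at h1
    rw [ih (E.erase i) (insert i R) (by rw [Finset.card_erase_of_mem hiE]; omega) hins
      ((Finset.erase_subset _ _).trans hE) (by
          rw [Finset.disjoint_insert_left]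
          exact ⟨Finset.notMem_erase _ _, hdis.mono_right (Finset.erase_subset _ _)⟩)]
    simp only [h1]

theorem wolseyGreedy_congr (tie : TieRule n) (f : Finset (Fin n) → ℝ) {x y : ℝ}
    (hxy : ∀ U ⊆ N, x < ∑ j ∈ U, c j ↔ y < ∑ j ∈ U, c j) :
    wolseyGreedy tie N f c x = wolseyGreedy tie N f c y := by
  classical
  have hfil : N.filter (fun i => c i ≤ x) = N.filter (fun i => c i ≤ y) := by
    refine Finset.filter_congr fun i hi => ?_
    have := hxy {i} (by simpa using hi)
    rw [Finset.sum_singleton] at this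
    rw [← not_lt, ← not_lt, this]
  have h2 := wolseyLoop_congr (N := N) (c := c) tie f hxy _ (N.filter (fun i => c i ≤ y)) ∅ rfl
    (Finset.empty_subset _) (Finset.filter_subset _ _) (Finset.disjoint_empty_left _)
  unfold wolseyGreedy
  convert h2 using 2

/-- Rounding a budget down to the cost of a set does not change the result of Wolsey's algorithm. -/
theorem exists_subset_sum_wolseyGreedy_eq (tie : TieRule n) (N : Finset (Fin n))
    (f : Finset (Fin n) → ℝ) (c : Fin n → ℝ) {x : ℝ} (hx : 0 ≤ x) :
    ∃ U ⊆ N, ∑ j ∈ U, c j ≤ x ∧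
      wolseyGreedy tie N f c (∑ j ∈ U, c j) = wolseyGreedy tie N f c x := by
  classical
  -- U is the costliest set within x, so no subset of N has a cost strictly above that of U and at
  -- most x.
  obtain ⟨U, hU, hmax⟩ := (N.powerset.filter (fun U => ∑ j ∈ U, c j ≤ x)).exists_max_image
    (fun U => ∑ j ∈ U, c j) ⟨∅, by simp [hx]⟩
  simp only [Finset.mem_filter, Finset.mem_powerset] at hU hmax
  refine ⟨U, hU.1, hU.2, wolseyGreedy_congr tie f fun V hV => ⟨fun h => ?_, hU.2.trans_lt⟩⟩
  by_contra hle
  exact absurd (hmax V ⟨hV, not_lt.1 hle⟩) (not_le.2 h)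

theorem chi_spec : Real.exp chi = 2 - chi := Classical.choose_spec exists_chi

/-- A crude bound (χ is about 0.44): at most 1/3 would give e^χ ≤ 3/2 < 5/3 ≤ 2 - χ. -/
theorem third_lt_chi : 1 / 3 < chi := by
  by_contra! h
  have h1 := Real.exp_le_exp.2 h
  have h2 : Real.exp (1 / 3) ≤ 3 / 2 := by
    have h3 := Real.add_one_le_exp (-(1 / 3) : ℝ)
    rw [Real.exp_neg] at h3
    have h4 := Real.exp_pos (1 / 3)
    rw [le_inv_comm₀ (by norm_num) h4] at h3
    norm_num at h3 ⊢
    exact h3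
  rw [chi_spec] at h1
  linarith

theorem alpha_pos : 0 < alpha := by
  have := third_lt_chi
  have : Real.exp (-chi) < 1 := Real.exp_lt_one_iff.2 (by linarith)
  unfold alpha
  linarith

/-- Here e^{-χ} = 1/(2 - χ). The value 2/5 is the guarantee of `le_wolseyGreedy`; nothing finer
about α is used than this and its positivity. -/
theorem alpha_le : alpha ≤ 2 / 5 := by
  have h := third_lt_chi
  have h2 := Real.exp_pos chi
  have h1 : (3 / 5 : ℝ) ≤ Real.exp (-chi) := by
    rw [Real.exp_neg, le_inv_comm₀ (by norm_num) h2, chi_spec]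
    norm_num
    linarith
  unfold alpha
  linarith

/-- The result of Wolsey's algorithm changes only at costs of subsets of N, so the smallest budget
is sought among finitely many values. The full cost of N qualifies. -/
theorem exists_isFindBudget (hf : SubmodularOn N f) (hf0 : f ∅ = 0) (hc : ∀ i, 0 < c i)
    (hN : N.Nonempty) : ∃ B, IsFindBudget N f c B := by
  classical
  obtain ⟨i₀, hi₀⟩ := hN
  let tie : TieRule n :=
    ⟨fun A => if h : A.Nonempty then h.choose else i₀, fun A h => by
      simp only [h, dite_true]; exact h.choose_spec⟩
  have hpos : 0 < ∑ i ∈ N, c i := Finset.sum_pos (fun i _ => hc i) ⟨i₀, hi₀⟩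
  have hfN : 0 ≤ f N := hf0 ▸ hf.le_of_subset (Finset.empty_subset N) subset_rfl
  have hmem : alpha * f N ≤ f (wolseyGreedy tie N f c (∑ i ∈ N, c i)) :=
    (mul_le_mul_of_nonneg_right alpha_le hfN).trans
      (le_wolseyGreedy hf hf0 hc tie subset_rfl hpos le_rfl le_rfl (Or.inr le_rfl))
  obtain ⟨U, hU, hmin⟩ := (N.powerset.filter
    (fun U => alpha * f N ≤ f (wolseyGreedy tie N f c (∑ i ∈ U, c i)))).exists_min_image
    (fun U => ∑ j ∈ U, c j) ⟨N, by simp [hmem]⟩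
  simp only [Finset.mem_filter, Finset.mem_powerset] at hU hmin
  refine ⟨∑ j ∈ U, c j, tie, ⟨Finset.sum_nonneg fun j _ => (hc j).le,
    Finset.sum_le_sum_of_subset_of_nonneg hU.1 fun j _ _ => (hc j).le, hU.2⟩, ?_⟩
  rintro x ⟨hx0, -, hx⟩
  obtain ⟨V, hVN, hVx, hV⟩ := exists_subset_sum_wolseyGreedy_eq tie N f c hx0
  exact (hmin V ⟨hVN, hV ▸ hx⟩).trans hVx

theorem IsFindBudget.pos {B : ℝ} (hB : IsFindBudget N f c B) (hf0 : f ∅ = 0) (hc : ∀ i, 0 < c i)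
    (hN : 0 < f N) : 0 < B := by
  classical
  obtain ⟨tie, ⟨h0, -, h⟩, -⟩ := hB
  refine h0.lt_of_ne fun h00 => ?_
  subst h00
  have : wolseyGreedy tie N f c 0 = ∅ := by
    have := (wolseyGreedy_subset (N := N) (c := c) tie f le_rfl).1
    rw [← Finset.subset_empty]
    refine this.trans fun i hi => ?_
    exact absurd (Finset.mem_filter.1 hi).2 (not_le.2 (hc i))
  rw [this, hf0] at h
  exact absurd h (not_le.2 (mul_pos alpha_pos hN))

/-- By minimality B cannot be rounded down, so it is the cost of a set of affordable items. Hence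
the first loop cannot run out of items before it has spent B. -/
theorem IsFindBudget.le_sum {B : ℝ} (hB : IsFindBudget N f c B) (hc : ∀ i, 0 < c i) :
    B ≤ ∑ j ∈ N.filter (fun i => c i ≤ B), c j := by
  obtain ⟨tie, ⟨h0, h1, h⟩, hmin⟩ := hB
  obtain ⟨U, hUN, hUB, hU⟩ := exists_subset_sum_wolseyGreedy_eq tie N f c h0
  have h2 : B ≤ ∑ j ∈ U, c j :=
    hmin ⟨Finset.sum_nonneg fun j _ => (hc j).le, hUB.trans h1, hU ▸ h⟩
  refine h2.trans (Finset.sum_le_sum_of_subset_of_nonneg (fun i hi => ?_) fun j _ _ => (hc j).le)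
  have := Finset.single_le_sum (f := c) (fun j _ => (hc j).le) hi
  exact Finset.mem_filter.2 ⟨hUN hi, this.trans hUB⟩

/-- The budget 4c(V) already passes the test of `IsFindBudget`, unless it exceeds the cost of N,
which bounds B anyway. -/
theorem IsFindBudget.le_four_mul {B : ℝ} (hB : IsFindBudget N f c B) (hf : SubmodularOn N f)
    (hf0 : f ∅ = 0) (hc : ∀ i, 0 < c i) (hN : 0 < f N) {V : Finset (Fin n)} (hVN : V ⊆ N)
    (hV : f V = f N) : B ≤ 4 * ∑ j ∈ V, c j := by
  obtain ⟨tie, ⟨h0, h1, h⟩, hmin⟩ := hB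
  have hVne : V.Nonempty := by
    rw [Finset.nonempty_iff_ne_empty]
    rintro rfl
    linarith
  have hpos : 0 < ∑ i ∈ V, c i := Finset.sum_pos (fun i _ => hc i) hVne
  rcases le_total (4 * ∑ j ∈ V, c j) (∑ j ∈ N, c j) with hle | hle
  · refine hmin ⟨by linarith, hle, ?_⟩
    have := le_wolseyGreedy hf hf0 hc tie hVN hpos le_rfl (B := 4 * ∑ j ∈ V, c j)
      (by linarith) (Or.inl le_rfl)
    rw [hV] at this
    exact (mul_le_mul_of_nonneg_right alpha_le hN.le).trans this
  · exact h1.trans hle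

/-- The set returned by Wolsey's algorithm is the benchmark for the second loop. -/
theorem IsFindBudget.exists_set {B : ℝ} (hB : IsFindBudget N f c B) :
    ∃ V ⊆ N.filter (fun i => c i ≤ B), ∑ j ∈ V, c j ≤ B ∧ alpha * f N ≤ f V := by
  obtain ⟨tie, ⟨h0, h1, h⟩, hmin⟩ := hB
  have := wolseyGreedy_subset (N := N) (c := c) tie f h0
  exact ⟨_, this.1, this.2, h⟩

end SetFunctions

/-! ### Partial realizations and the two set functions of a call. -/

section Realizations

variable {n : ℕ} {Γ : Type*}

theorem Partial.ExtendedBy.trans {b d e : Partial n Γ} (h : b.ExtendedBy d)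
    (h' : d.ExtendedBy e) : b.ExtendedBy e := fun i hi => by
  rw [h' i (by rw [h i hi]; exact hi), h i hi]

theorem Partial.extendedBy_set {b : Partial n Γ} {i : Fin n} (hi : b i = none) (γ : Γ) :
    b.ExtendedBy (b.set i γ) := fun j hj => by
  have : j ≠ i := fun h => hj (h ▸ hi)
  simp [Partial.set, this]

theorem Partial.set_extendedBy_iff {b d : Partial n Γ} {i : Fin n} (hi : b i = none) (γ : Γ) :
    (b.set i γ).ExtendedBy d ↔ b.ExtendedBy d ∧ d i = some γ := by
  constructor
  · intro h
    exact ⟨(Partial.extendedBy_set hi γ).trans h, by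
      have := h i (by simp [Partial.set])
      simpa [Partial.set] using this⟩
  · rintro ⟨h1, h2⟩ j hj
    by_cases hji : j = i
    · subst hji; simp [Partial.set, h2]
    · simp only [Partial.set, Function.update_of_ne hji] at hj ⊢
      exact h1 j hj

theorem IsMonotone.le_of_extendedBy {g : Partial n Γ → ℕ} (hg : IsMonotone g)
    {b d : Partial n Γ} (h : b.ExtendedBy d) : g b ≤ g d := by
  classical
  have key : ∀ k, ∀ b : Partial n Γ, b.ExtendedBy d →
      (Finset.univ.filter (fun i => b i ≠ d i)).card = k → g b ≤ g d := by
    intro k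
    induction k with
    | zero =>
      intro b _ hk
      rw [Finset.card_eq_zero, Finset.filter_eq_empty_iff] at hk
      have : b = d := funext fun i => not_not.1 (hk (Finset.mem_univ i))
      rw [this]
    | succ k ih =>
      intro b hb hk
      obtain ⟨i, hi⟩ := Finset.card_pos.1 (by omega :
        0 < (Finset.univ.filter (fun i => b i ≠ d i)).card)
      have hne := (Finset.mem_filter.1 hi).2
      have hbi : b i = none := by
        by_contra hbi
        exact hne (hb i hbi).symm
      obtain ⟨γ, hγ⟩ : ∃ γ, d i = some γ := by
        cases hd : d i with
        | none => exact absurd (hbi.trans hd.symm) hne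
        | some γ => exact ⟨γ, rfl⟩
      refine (hg b i γ hbi).trans (ih _ ((Partial.set_extendedBy_iff hbi γ).2 ⟨hb, hγ⟩) ?_)
      have : (Finset.univ.filter (fun j => b.set i γ j ≠ d j)) =
          (Finset.univ.filter (fun j => b j ≠ d j)).erase i := by
        ext j
        rw [Finset.mem_erase, Finset.mem_filter, Finset.mem_filter]
        by_cases hj : j = i
        · subst hj; simp [Partial.set, hγ]
        · simp [Partial.set, hj]
      rw [this, Finset.card_erase_of_mem hi, hk]
      rfl
  exact key _ b h rfl

namespace Problem

theorem mem_unknown {b : Partial n Γ} {i : Fin n} : i ∈ unknown b ↔ b i = none := by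
  simp [unknown]

theorem extendBy_empty (b : Partial n Γ) (σ : Fin n → Γ) : extendBy b σ ∅ = b := by
  funext i; simp [extendBy]

theorem extendBy_insert (b : Partial n Γ) (σ : Fin n → Γ) (R : Finset (Fin n)) (i : Fin n) :
    extendBy b σ (insert i R) = (extendBy b σ R).set i (σ i) := by
  funext j
  by_cases hj : j = i
  · subst hj; simp [extendBy, Partial.set]
  · simp [extendBy, Partial.set, hj]

theorem extendBy_of_notMem {b : Partial n Γ} {σ : Fin n → Γ} {R : Finset (Fin n)} {i : Fin n}
    (hi : i ∉ R) : extendBy b σ R i = b i := by simp [extendBy, hi]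

theorem extendedBy_extendBy {b : Partial n Γ} {σ : Fin n → Γ} {R : Finset (Fin n)}
    (hR : R ⊆ unknown b) : b.ExtendedBy (extendBy b σ R) := fun i hi => by
  have : i ∉ R := fun h => hi (mem_unknown.1 (hR h))
  rw [extendBy_of_notMem this]

theorem extendBy_mono {b : Partial n Γ} {σ : Fin n → Γ} {R R' : Finset (Fin n)}
    (hR : R ⊆ R') (hR' : R' ⊆ unknown b) : (extendBy b σ R).ExtendedBy (extendBy b σ R') := by
  intro i hi
  by_cases h : i ∈ R
  · simp [extendBy, h, hR h]
  · rw [extendBy_of_notMem h] at hi ⊢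
    exact extendBy_of_notMem fun h' => hi (mem_unknown.1 (hR' h'))

variable (P : Problem n Γ)

theorem nonempty_realization {n : ℕ} {Γ : Type*} (P : Problem n Γ) : Nonempty (Fin n → Γ) :=
  ⟨P.S_nonempty.choose⟩

theorem g_eq_of_unknown_eq_empty {b : Partial n Γ} (hb : unknown b = ∅) : P.g b = P.Q := by
  have h : ∀ i, b i ≠ none := fun i hi => by
    have : i ∈ unknown b := mem_unknown.2 hi
    simp [hb] at this
  choose a ha using fun i => Option.ne_none_iff_exists'.1 (h i)
  rw [← P.g_goal a]
  congr 1
  funext i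
  exact ha i

theorem g_le (b : Partial n Γ) : P.g b ≤ P.Q := by
  obtain ⟨a⟩ := P.nonempty_realization
  rw [← P.g_goal (fun i => (b i).getD (a i))]
  refine P.g_monotone.le_of_extendedBy fun i hi => ?_
  obtain ⟨x, hx⟩ := Option.ne_none_iff_exists'.1 hi
  simp [full, hx]

theorem utilityAlong_empty (b : Partial n Γ) (σ : Fin n → Γ) : P.utilityAlong b σ ∅ = 0 := by
  simp [utilityAlong, extendBy_empty]

theorem utilityAlong_unknown (b : Partial n Γ) (σ : Fin n → Γ) :
    P.utilityAlong b σ (unknown b) = (P.Q : ℝ) - P.g b := by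
  unfold utilityAlong
  rw [P.g_eq_of_unknown_eq_empty (b := extendBy b σ (unknown b))]
  ext i
  rw [mem_unknown]
  by_cases hi : i ∈ unknown b
  · simp [extendBy, hi]
  · rw [extendBy_of_notMem hi, ← mem_unknown]; simp [hi]

theorem utilityAlong_insert_sub (b : Partial n Γ) (σ : Fin n → Γ) (R : Finset (Fin n))
    (i : Fin n) : P.utilityAlong b σ (insert i R) - P.utilityAlong b σ R =
      gain P.g (extendBy b σ R) i (σ i) := by
  simp [utilityAlong, gain, extendBy_insert]

theorem submodularOn_utilityAlong (b : Partial n Γ) (σ : Fin n → Γ) :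
    SubmodularOn (unknown b) (P.utilityAlong b σ) := by
  have hmono : ∀ R ⊆ unknown b, ∀ i ∈ unknown b,
      P.utilityAlong b σ R ≤ P.utilityAlong b σ (insert i R) := by
    intro R hR i hi
    have := P.g_monotone.le_of_extendedBy (extendBy_mono (σ := σ) (Finset.subset_insert i R)
      (Finset.insert_subset hi hR))
    unfold utilityAlong
    have : (P.g (extendBy b σ R) : ℝ) ≤ P.g (extendBy b σ (insert i R)) := by exact_mod_cast this
    linarith
  refine ⟨hmono, fun R R' hRR' hR' i hi => ?_⟩
  -- Submodularity of g concerns unknown items only; an item of R' has no further gain, and there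
  -- monotonicity suffices.
  by_cases hiR' : i ∈ R'
  · rw [Finset.insert_eq_of_mem hiR']
    have := hmono R (hRR'.trans hR') i hi
    linarith
  · rw [utilityAlong_insert_sub, utilityAlong_insert_sub]
    have hb := mem_unknown.1 hi
    refine P.g_submodular _ _ i _ (extendBy_mono hRR' hR') ?_ ?_
    · rw [extendBy_of_notMem fun h => hiR' (hRR' h), hb]
    · rw [extendBy_of_notMem hiR', hb]

/-- This is a coverage function: the marginal of i at R is the weight of the elements that follow σ
on R and leave it at i, and that set of elements shrinks as R grows. -/
theorem submodularOn_removedWeight (b : Partial n Γ) (σ : Fin n → Γ) (N : Finset (Fin n)) :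
    SubmodularOn N (P.removedWeight b σ) := by
  classical
  have key : ∀ R i, P.removedWeight b σ (insert i R) - P.removedWeight b σ R =
      ∑ a ∈ P.S.filter (fun a => b.ExtendedBy (full a) ∧ (∀ j ∈ R, a j = σ j) ∧ a i ≠ σ i),
        (P.w a : ℝ) := by
    intro R i
    unfold removedWeight
    simp only [Finset.sum_filter]
    rw [← Finset.sum_sub_distrib]
    refine Finset.sum_congr rfl fun a _ => ?_
    have e1 : (∀ j ∈ R, a j = σ j) ↔ ¬ ∃ j ∈ R, a j ≠ σ j := by push Not; rfl
    simp only [Finset.exists_mem_insert, e1]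
    by_cases h1 : b.ExtendedBy (full a) <;> by_cases h2 : ∃ j ∈ R, a j ≠ σ j <;>
      by_cases h3 : a i = σ i <;> simp only [h1, h2, h3] <;> simp
  refine ⟨fun R _ i _ => ?_, fun R R' hRR' _ i _ => ?_⟩
  · rw [← sub_nonneg, key]
    exact Finset.sum_nonneg fun a _ => Nat.cast_nonneg _
  · rw [key, key]
    refine Finset.sum_le_sum_of_subset_of_nonneg (fun a ha => ?_) fun a _ _ => Nat.cast_nonneg _
    simp only [Finset.mem_filter] at ha ⊢
    exact ⟨ha.1, ha.2.1, fun j hj => ha.2.2.1 j (hRR' hj), ha.2.2.2⟩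

theorem nextToWorstFractions_nonneg : ∀ x ∈ P.nextToWorstFractions, 0 ≤ x := by
  rintro x ⟨b, i, worst, γ, hb, hi, -, -, rfl⟩
  have h1 : (P.g b : ℝ) ≤ P.g (b.set i γ) := by exact_mod_cast P.g_monotone b i γ hi
  have h2 : (P.g b : ℝ) < P.Q := by exact_mod_cast hb
  exact div_nonneg (by unfold gain; linarith) (by linarith)

theorem rho_mul_le_gain {b : Partial n Γ} {i : Fin n} {worst γ : Γ} (hb : P.g b < P.Q)
    (hi : b i = none) (hw : IsWorstState P.g b i worst) (hγ : γ ≠ worst) :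
    P.rho * ((P.Q : ℝ) - P.g b) ≤ gain P.g b i γ := by
  have hmem : gain P.g b i γ / ((P.Q : ℝ) - P.g b) ∈ P.nextToWorstFractions :=
    ⟨b, i, worst, γ, hb, hi, hw, hγ, rfl⟩
  have h2 : (P.g b : ℝ) < P.Q := by exact_mod_cast hb
  unfold rho
  rw [if_pos ⟨_, hmem⟩, ← le_div_iff₀ (by linarith)]
  exact csInf_le ⟨0, fun x hx => P.nextToWorstFractions_nonneg x hx⟩ hmem

theorem rho_le_one : P.rho ≤ 1 := by
  unfold rho
  split_ifs with h
  · obtain ⟨x, hx⟩ := h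
    refine (csInf_le ⟨0, fun x hx => P.nextToWorstFractions_nonneg x hx⟩ hx).trans ?_
    obtain ⟨b, i, worst, γ, hb, hi, -, -, rfl⟩ := hx
    have h1 : (P.g (b.set i γ) : ℝ) ≤ P.Q := by exact_mod_cast P.g_le _
    have h2 : (P.g b : ℝ) < P.Q := by exact_mod_cast hb
    rw [div_le_one (by linarith)]
    unfold gain
    linarith
  · exact le_rfl

theorem unknown_set (b : Partial n Γ) (i : Fin n) (γ : Γ) :
    unknown (b.set i γ) = (unknown b).erase i := by
  ext j
  rw [Finset.mem_erase, mem_unknown, mem_unknown]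
  by_cases hj : j = i
  · subst hj; simp [Partial.set]
  · simp [Partial.set, hj]

theorem card_unknown_set_lt {b : Partial n Γ} {i : Fin n} (hi : b i = none) (γ : Γ) :
    (unknown (b.set i γ)).card < (unknown b).card := by
  rw [unknown_set]
  exact Finset.card_erase_lt_of_mem (mem_unknown.2 hi)

theorem utilityAlong_unknown_pos {b : Partial n Γ} (hb : P.g b ≠ P.Q) (σ : Fin n → Γ) :
    0 < P.utilityAlong b σ (unknown b) := by
  rw [utilityAlong_unknown]
  have : (P.g b : ℝ) < P.Q := by exact_mod_cast lt_of_le_of_ne (P.g_le b) hb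
  linarith

/-! ### Runs of the algorithm: existence and correctness. -/

/-- The second loop can be run to completion. -/
theorem exists_builds_second (σ : Fin n → Γ) (B : ℝ) (m k : ℕ)
    (hcall : ∀ d : Partial n Γ, (unknown d).card < m → ∃ T, P.Builds (.call d) T) :
    ∀ (b : Partial n Γ) (I : Finset (Fin n)) (s : ℝ), I.card = k → I ⊆ unknown b →
      (unknown b).card < m → ∃ T, P.Builds (.second σ B b I s) T := by
  induction k with
  | zero =>
    intro b I s hk _ hb
    obtain ⟨T, hT⟩ := hcall b hb
    exact ⟨T, .secondExit _ _ _ _ _ _ (Or.inr (Finset.card_eq_zero.1 hk)) hT⟩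
  | succ k ih =>
    intro b I s hk hI hb
    rcases le_or_gt B s with hs | hs
    · obtain ⟨T, hT⟩ := hcall b hb
      exact ⟨T, .secondExit _ _ _ _ _ _ (Or.inl hs) hT⟩
    obtain ⟨i, hi, hmax⟩ := I.exists_max_image (fun j => gain P.g b j (σ j) / P.c j)
      (Finset.card_pos.1 (by omega))
    have hbi := mem_unknown.1 (hI hi)
    have hlt := fun γ => (card_unknown_set_lt hbi γ).trans hb
    obtain ⟨T, hT⟩ := ih (b.set i (σ i)) (I.erase i) (s + P.c i)
      (by rw [Finset.card_erase_of_mem hi]; omega)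
      (by rw [unknown_set]; exact Finset.erase_subset_erase i hI) (hlt _)
    choose child hchild using fun γ => hcall (b.set i γ) (hlt γ)
    classical
    refine ⟨.node i (Function.update child (σ i) T),
      .secondStep _ _ _ _ _ _ _ hs hi hmax (fun γ hγ => ?_) ?_⟩
    · rw [Function.update_of_ne hγ]; exact hchild γ
    · rw [Function.update_self]; exact hT

/-- The first loop can be run to completion if the available items can use up the budget. -/
theorem exists_builds_first (σ : Fin n → Γ) {B : ℝ} (hB : 0 < B) (m k : ℕ)
    (hcall : ∀ d : Partial n Γ, (unknown d).card < m → ∃ T, P.Builds (.call d) T)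
    (b₀ : Partial n Γ) :
    ∀ (b : Partial n Γ) (R I : Finset (Fin n)) (s : ℝ), I.card = k → I ⊆ unknown b →
      (unknown b).card ≤ m → (0 < s → (unknown b).card < m) → B ≤ s + ∑ i ∈ I, P.c i →
      ∃ T, P.Builds (.first b₀ σ B b R I s) T := by
  induction k with
  | zero =>
    intro b R I s hk hI _ hm hsB
    have hI0 := Finset.card_eq_zero.1 hk
    have hs : B ≤ s := by simpa [hI0] using hsB
    -- As B > 0, having spent B means that some item has been fixed, so the last call has fewer
    -- unknown items than the current one.
    obtain ⟨T, hT⟩ := P.exists_builds_second σ B m _ hcall b I 0 rfl hI (hm (hB.trans_le hs))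
    exact ⟨T, .firstExit _ _ _ _ _ _ _ _ hs hT⟩
  | succ k ih =>
    intro b R I s hk hI hbm hm hsB
    rcases le_or_gt B s with hs | hs
    · obtain ⟨T, hT⟩ := P.exists_builds_second σ B m _ hcall b I 0 rfl hI (hm (hB.trans_le hs))
      exact ⟨T, .firstExit _ _ _ _ _ _ _ _ hs hT⟩
    obtain ⟨i, hi, hmax⟩ := I.exists_max_image
      (fun j => (P.removedWeight b₀ σ (insert j R) - P.removedWeight b₀ σ R) / P.c j)
      (Finset.card_pos.1 (by omega))
    have hbi := mem_unknown.1 (hI hi)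
    have hlt := fun γ => (card_unknown_set_lt hbi γ).trans_le hbm
    obtain ⟨T, hT⟩ := ih (b.set i (σ i)) (insert i R) (I.erase i) (s + P.c i)
      (by rw [Finset.card_erase_of_mem hi]; omega)
      (by rw [unknown_set]; exact Finset.erase_subset_erase i hI) (hlt _).le (fun _ => hlt _)
      (by have := Finset.sum_erase_add I P.c hi; linarith)
    choose child hchild using fun γ => hcall (b.set i γ) (hlt γ)
    classical
    refine ⟨.node i (Function.update child (σ i) T),
      .firstStep _ _ _ _ _ _ _ _ _ hs ⟨hi, hmax⟩ (fun γ hγ => ?_) ?_⟩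
    · rw [Function.update_of_ne hγ]; exact hchild γ
    · rw [Function.update_self]; exact hT

theorem exists_builds_call [Finite Γ] (k : ℕ) : ∀ b : Partial n Γ, (unknown b).card = k →
    ∃ T, P.Builds (.call b) T := by
  induction k using Nat.strong_induction_on with
  | _ k ih =>
    intro b hk
    by_cases hb : P.g b = P.Q
    · exact ⟨.leaf, .done b hb⟩
    have hne : (unknown b).Nonempty := by
      rw [Finset.nonempty_iff_ne_empty]
      exact fun h => hb (P.g_eq_of_unknown_eq_empty h)
    have hσ : ∀ i, ∃ γ, IsWorstState P.g b i γ := fun i => by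
      obtain ⟨a⟩ := P.nonempty_realization
      have : Nonempty Γ := ⟨a i⟩
      exact Finite.exists_min (gain P.g b i)
    choose σ hσ using hσ
    have hf := P.submodularOn_utilityAlong b σ
    have hf0 := P.utilityAlong_empty b σ
    obtain ⟨B, hB⟩ := exists_isFindBudget hf hf0 P.c_pos hne
    have hBpos := hB.pos hf0 P.c_pos (P.utilityAlong_unknown_pos hb σ)
    obtain ⟨T, hT⟩ := P.exists_builds_first σ hBpos k _ (fun d hd => ih _ hd d rfl) b b ∅
      ((unknown b).filter (fun i => P.c i ≤ B)) 0 rfl (Finset.filter_subset _ _) hk.le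
      (fun h => absurd h (lt_irrefl 0)) (by rw [zero_add]; exact hB.le_sum P.c_pos)
    exact ⟨T, .start b σ B T hb (fun i _ => hσ i) hB (by convert hT)⟩

/-- What `SolvesFrom` means at a control state. -/
def SolvesControl (s : Control n Γ) (T : DTree n Γ) : Prop :=
  match s with
  | .call b => T.SolvesFrom P.g P.Q b
  | .first _ _ _ b _ I _ => I ⊆ unknown b → T.SolvesFrom P.g P.Q b
  | .second _ _ b I _ => I ⊆ unknown b → T.SolvesFrom P.g P.Q b

theorem Builds.solvesControl {s : Control n Γ} {T : DTree n Γ} (h : P.Builds s T) :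
    P.SolvesControl s T := by
  have hset : ∀ {b : Partial n Γ} {I : Finset (Fin n)} {i : Fin n} {γ : Γ},
      I ⊆ unknown b → I.erase i ⊆ unknown (b.set i γ) := fun hI => by
    rw [unknown_set]; exact Finset.erase_subset_erase _ hI
  induction h with
  | done b hb => exact hb
  | start b σ B T hb hσ hB hT ih => exact ih (Finset.filter_subset _ _)
  | firstStep b₀ σ B b R I s i child hs hi hrec hnext ih1 ih2 =>
    intro hI
    refine ⟨mem_unknown.1 (hI hi.1), fun γ => ?_⟩
    by_cases hγ : γ = σ i
    · subst hγ; exact ih2 (hset hI)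
    · exact ih1 γ hγ
  | firstExit b₀ σ B b R I s T hs hT ih => exact ih
  | secondStep σ B b I s i child hs hi hmax hrec hnext ih1 ih2 =>
    intro hI
    refine ⟨mem_unknown.1 (hI hi), fun γ => ?_⟩
    by_cases hγ : γ = σ i
    · subst hγ; exact ih2 (hset hI)
    · exact ih1 γ hγ
  | secondExit σ B b I s T hs hT ih => exact fun _ => ih

end Problem

end Realizations


/-! ### The threshold that minimizes the potential. -/

/-- A minimizer `t` of the convex function `t ↦ y t + ∑ w_a (x_a - t)⁺`. -/
theorem exists_threshold {ι : Type*} (S : Finset ι) {w x : ι → ℝ} (hw : ∀ a, 0 ≤ w a) {y L : ℝ}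
    (hL : 0 < L) (hy : ∑ a ∈ S, w a * (if L ≤ x a then 1 else 0) < y) :
    ∃ t, 0 ≤ t ∧ t < L ∧ ∑ a ∈ S, w a * (if t < x a then 1 else 0) ≤ y ∧
      ∀ u, 0 ≤ u → y * t + ∑ a ∈ S, w a * max (x a - t) 0 ≤
        y * u + ∑ a ∈ S, w a * max (x a - u) 0 := by
  classical
  -- The function is piecewise linear with breakpoints among 0 and the x_a; this is the last
  -- breakpoint below z.
  have hpred : ∀ z : ℝ, 0 < z → ∃ t ∈ insert 0 (S.image x), 0 ≤ t ∧ t < z ∧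
      ∀ a ∈ S, t < x a → z ≤ x a := by
    intro z hz
    obtain ⟨t, ht, hmax⟩ := ((insert 0 (S.image x)).filter (· < z)).exists_max_image id
      ⟨0, by simp [hz]⟩
    simp only [Finset.mem_filter, id] at ht hmax
    refine ⟨t, ht.1, hmax 0 ⟨by simp, hz⟩, ht.2, fun a ha hta => ?_⟩
    by_contra! hlt
    exact absurd (hmax (x a) ⟨Finset.mem_insert_of_mem (Finset.mem_image_of_mem x ha), hlt⟩)
      (not_le.2 hta)
  have hstep : ∀ t z : ℝ, (∀ a ∈ S, t < x a → z ≤ x a) →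
      ∑ a ∈ S, w a * (if t < x a then 1 else 0) ≤ ∑ a ∈ S, w a * (if z ≤ x a then 1 else 0) := by
    intro t z h
    refine Finset.sum_le_sum fun a ha => mul_le_mul_of_nonneg_left ?_ (hw a)
    by_cases h1 : t < x a
    · rw [if_pos h1, if_pos (h a ha h1)]
    · rw [if_neg h1]; split_ifs <;> norm_num
  obtain ⟨t₀, ht₀, ht₀0, ht₀L, ht₀x⟩ := hpred L hL
  -- The least breakpoint beyond which the weight is at most y. The hypothesis `hy` places it below
  -- L.
  obtain ⟨t, ht, hmin⟩ := ((insert 0 (S.image x)).filter (fun t => 0 ≤ t ∧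
      ∑ a ∈ S, w a * (if t < x a then 1 else 0) ≤ y)).exists_min_image id
    ⟨t₀, Finset.mem_filter.2 ⟨ht₀, ht₀0, (hstep _ _ ht₀x).trans hy.le⟩⟩
  simp only [Finset.mem_filter, id] at ht hmin
  refine ⟨t, ht.2.1, (hmin _ ⟨ht₀, ht₀0, (hstep _ _ ht₀x).trans hy.le⟩).trans_lt ht₀L,
    ht.2.2, fun u hu => ?_⟩
  rcases le_or_gt t u with htu | hut
  · have h1 : ∑ a ∈ S, w a * max (x a - t) 0 ≤ ∑ a ∈ S, w a * max (x a - u) 0 +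
        (u - t) * ∑ a ∈ S, w a * (if t < x a then 1 else 0) := by
      rw [Finset.mul_sum, ← Finset.sum_add_distrib]
      refine Finset.sum_le_sum fun a _ => ?_
      have : max (x a - t) 0 ≤ max (x a - u) 0 + (u - t) * (if t < x a then 1 else 0) := by
        split_ifs with h
        · have := le_max_left (x a - u) 0
          exact max_le (by linarith) (by linarith [le_max_right (x a - u) 0])
        · rw [max_eq_right (by linarith)]
          simp
      have := mul_le_mul_of_nonneg_left this (hw a)
      linarith
    have h2 := mul_le_mul_of_nonneg_left ht.2.2 (sub_nonneg.2 htu)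
    linarith
  · obtain ⟨t₁, ht₁, ht₁0, ht₁t, ht₁x⟩ := hpred t (hu.trans_lt hut)
    -- The preceding breakpoint fails the condition, so the weight of the x_a ≥ t is at least y and
    -- the function does not increase up to t.
    have h0 : y < ∑ a ∈ S, w a * (if t₁ < x a then 1 else 0) := by
      by_contra! h
      exact absurd (hmin t₁ ⟨ht₁, ht₁0, h⟩) (not_le.2 ht₁t)
    have h3 := h0.le.trans (hstep _ _ ht₁x)
    have h1 : ∑ a ∈ S, w a * max (x a - t) 0 +
        (t - u) * ∑ a ∈ S, w a * (if t ≤ x a then 1 else 0) ≤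
          ∑ a ∈ S, w a * max (x a - u) 0 := by
      rw [Finset.mul_sum, ← Finset.sum_add_distrib]
      refine Finset.sum_le_sum fun a _ => ?_
      have : max (x a - t) 0 + (t - u) * (if t ≤ x a then 1 else 0) ≤ max (x a - u) 0 := by
        split_ifs with h
        · rw [max_eq_left (by linarith), max_eq_left (by linarith)]
          linarith
        · rw [max_eq_right (by linarith)]
          simp
      have := mul_le_mul_of_nonneg_left this (hw a)
      linarith
    have h2 := mul_le_mul_of_nonneg_left h3 (sub_nonneg.2 hut.le)
    linarith

/-! ### Paths in decision trees. -/

namespace DTree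

variable {n : ℕ} {Γ : Type*} {c : Fin n → ℝ}

theorem pathCost_nonneg (hc : ∀ i, 0 < c i) (τ : DTree n Γ) (a : Fin n → Γ) :
    0 ≤ τ.pathCost c a := by
  induction τ with
  | leaf => exact le_rfl
  | node i child ih => exact add_nonneg (hc i).le (ih _)

/-- The items on the path of `a` in a tree up to total cost `x`. -/
noncomputable def prefixItems (c : Fin n → ℝ) : DTree n Γ → (Fin n → Γ) → ℝ → Finset (Fin n)
  | .leaf, _, _ => ∅
  | .node i child, a, x =>
    if c i ≤ x then insert i ((child (a i)).prefixItems c a (x - c i)) else ∅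

theorem sum_prefixItems_le (hc : ∀ i, 0 < c i) (τ : DTree n Γ) (a : Fin n → Γ) :
    ∀ {x : ℝ}, 0 ≤ x → ∑ i ∈ τ.prefixItems c a x, c i ≤ x := by
  induction τ with
  | leaf => intro x hx; simpa [prefixItems] using hx
  | node i child ih =>
    intro x hx
    rw [prefixItems]
    split_ifs with h
    · have h1 := ih (a i) (sub_nonneg.2 h)
      by_cases hi : i ∈ (child (a i)).prefixItems c a (x - c i)
      · rw [Finset.insert_eq_of_mem hi]
        linarith [hc i]
      · rw [Finset.sum_insert hi]
        linarith
    · simpa using hx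

/-- If a agreed with d on that prefix, both would follow the same path up to cost x, and the path of
a ends by then while that of d does not. -/
theorem exists_ne_of_pathCost_lt (hc : ∀ i, 0 < c i) (τ : DTree n Γ) (a d : Fin n → Γ) :
    ∀ {x : ℝ}, τ.pathCost c a ≤ x → x < τ.pathCost c d →
      ∃ i ∈ τ.prefixItems c d x, a i ≠ d i := by
  induction τ with
  | leaf => intro x h1 h2; exact absurd (h1.trans_lt h2) (lt_irrefl _)
  | node i child ih =>
    intro x h1 h2
    rw [pathCost] at h1 h2
    have h3 := (child (a i)).pathCost_nonneg hc a
    rw [prefixItems, if_pos (by linarith)]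
    by_cases h : a i = d i
    · rw [h] at h1
      obtain ⟨j, hj, hne⟩ := ih (d i) (x := x - c i) (by linarith) (by linarith)
      exact ⟨j, Finset.mem_insert_of_mem hj, hne⟩
    · exact ⟨i, Finset.mem_insert_self _ _, h⟩

/-- The leaf reached by a is extended by d, and its utility is already Q. -/
theorem SolvesFrom.le_of_prefixItems {g : Partial n Γ → ℕ} (hg : IsMonotone g) {Q : ℕ}
    (hc : ∀ i, 0 < c i) (a : Fin n → Γ) {d : Partial n Γ} (τ : DTree n Γ) :
    ∀ {b : Partial n Γ} {x : ℝ}, τ.SolvesFrom g Q b → τ.pathCost c a ≤ x → b.ExtendedBy d →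
      (∀ i ∈ τ.prefixItems c a x, d i = some (a i)) → Q ≤ g d := by
  induction τ with
  | leaf => intro b x h _ hbd _; exact h ▸ hg.le_of_extendedBy hbd
  | node i child ih =>
    intro b x h hx hbd hd
    rw [pathCost] at hx
    have h3 := (child (a i)).pathCost_nonneg hc a
    rw [prefixItems, if_pos (by linarith)] at hd
    exact ih (a i) (h.2 (a i)) (x := x - c i) (by linarith)
      ((Partial.set_extendedBy_iff h.1 _).2 ⟨hbd, hd i (Finset.mem_insert_self _ _)⟩)
      fun j hj => hd j (Finset.mem_insert_of_mem hj)

end DTree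

/-! ### Depth of the recursion. -/

/-- The number of levels of recursion needed if every recursive call reduces the distance `q` to
the goal value by a factor `1 - δ`. -/
noncomputable def recursionBound (δ : ℝ) (q : ℕ) : ℝ := if q = 0 then 0 else 1 + Real.log q / δ

/-- Since 1 - δ ≤ e^{-δ}, the logarithm drops by δ, which cancels the summand 1. The separate value
at 0 covers calls that have reached the goal. -/
theorem recursionBound_le {δ : ℝ} (hδ : 0 < δ) {q q' : ℕ} (hq : q ≠ 0)
    (h : (q' : ℝ) ≤ (1 - δ) * q) : recursionBound δ q' ≤ Real.log q / δ := by
  have hq1 : (1 : ℝ) ≤ q := by exact_mod_cast Nat.one_le_iff_ne_zero.2 hq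
  unfold recursionBound
  split_ifs with h0
  · exact div_nonneg (Real.log_nonneg hq1) hδ.le
  · have hq' : (0 : ℝ) < q' := by exact_mod_cast Nat.pos_of_ne_zero h0
    have hle : (q' : ℝ) ≤ Real.exp (-δ) * q :=
      h.trans (mul_le_mul_of_nonneg_right (by linarith [Real.add_one_le_exp (-δ)]) (by linarith))
    have h1 := Real.log_le_log hq' hle
    rw [Real.log_mul (Real.exp_ne_zero _) (by linarith), Real.log_exp] at h1
    rw [le_div_iff₀ hδ, add_mul, div_mul_cancel₀ _ hδ.ne']
    linarith

/-! ### Masses of the compatible sample, and lower bounds from a solution. -/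

namespace Problem

variable {n : ℕ} {Γ : Type*} (P : Problem n Γ)

open Classical in
/-- The sum of `w(a) φ(a)` over the sample elements `a ⪰ b`. -/
noncomputable def mass (b : Partial n Γ) (φ : (Fin n → Γ) → ℝ) : ℝ :=
  ∑ a ∈ P.S.filter (fun a => b.ExtendedBy (full a)), (P.w a : ℝ) * φ a

theorem mass_mono {b : Partial n Γ} {φ ψ : (Fin n → Γ) → ℝ} (h : ∀ a, φ a ≤ ψ a) :
    P.mass b φ ≤ P.mass b ψ :=
  Finset.sum_le_sum fun a _ => mul_le_mul_of_nonneg_left (h a) (Nat.cast_nonneg _)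

theorem mass_nonneg {b : Partial n Γ} {φ : (Fin n → Γ) → ℝ} (h : ∀ a, 0 ≤ φ a) :
    0 ≤ P.mass b φ :=
  Finset.sum_nonneg fun a _ => mul_nonneg (Nat.cast_nonneg _) (h a)

theorem mass_const_mul (b : Partial n Γ) (r : ℝ) (φ : (Fin n → Γ) → ℝ) :
    P.mass b (fun a => r * φ a) = r * P.mass b φ := by
  unfold mass
  rw [Finset.mul_sum]
  exact Finset.sum_congr rfl fun a _ => by ring

theorem mass_eq_sum_set [Fintype Γ] {b : Partial n Γ} {i : Fin n} (hi : b i = none)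
    (φ : (Fin n → Γ) → ℝ) : P.mass b φ = ∑ γ, P.mass (b.set i γ) φ := by
  classical
  unfold mass
  rw [← Finset.sum_fiberwise _ (fun a => a i)]
  refine Finset.sum_congr rfl fun γ _ => Finset.sum_congr ?_ fun _ _ => rfl
  ext a
  simp [Partial.set_extendedBy_iff hi, full, and_assoc]

theorem mass_set_le [Finite Γ] {b : Partial n Γ} {i : Fin n} (hi : b i = none) (γ : Γ)
    {φ : (Fin n → Γ) → ℝ} (h : ∀ a, 0 ≤ φ a) : P.mass (b.set i γ) φ ≤ P.mass b φ := by
  have := Fintype.ofFinite Γ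
  rw [P.mass_eq_sum_set hi]
  exact Finset.single_le_sum (f := fun γ => P.mass (b.set i γ) φ)
    (fun γ _ => P.mass_nonneg h) (Finset.mem_univ γ)

theorem mass_pathCost_node [Fintype Γ] {b : Partial n Γ} {i : Fin n} (hi : b i = none)
    (child : Γ → DTree n Γ) :
    P.mass b ((DTree.node i child).pathCost P.c) = P.c i * P.mass b (fun _ => 1) +
      ∑ γ, P.mass (b.set i γ) ((child γ).pathCost P.c) := by
  classical
  rw [← mass_const_mul, P.mass_eq_sum_set hi, P.mass_eq_sum_set hi, ← Finset.sum_add_distrib]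
  refine Finset.sum_congr rfl fun γ _ => ?_
  unfold mass
  rw [← Finset.sum_add_distrib]
  refine Finset.sum_congr rfl fun a ha => ?_
  have := ((Partial.set_extendedBy_iff hi γ).1 (Finset.mem_filter.1 ha).2).2
  simp only [full, Option.some.injEq] at this
  rw [DTree.pathCost, this]
  ring

/-- The cost of a node, when all children but one are bounded by a multiple of the mass of `φ`. -/
theorem mass_pathCost_node_le [Finite Γ] {b : Partial n Γ} {i : Fin n} (hi : b i = none)
    {child : Γ → DTree n Γ} {M X : ℝ} {φ : (Fin n → Γ) → ℝ} (s : Γ)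
    (h : ∀ γ, γ ≠ s → P.mass (b.set i γ) ((child γ).pathCost P.c) ≤ M * P.mass (b.set i γ) φ)
    (hs : P.mass (b.set i s) ((child s).pathCost P.c) ≤ X + M * P.mass (b.set i s) φ) :
    P.mass b ((DTree.node i child).pathCost P.c) ≤
      P.c i * P.mass b (fun _ => 1) + X + M * P.mass b φ := by
  classical
  have := Fintype.ofFinite Γ
  rw [P.mass_pathCost_node hi, P.mass_eq_sum_set hi φ, Finset.mul_sum,
    ← Finset.add_sum_erase _ _ (Finset.mem_univ s),
    ← Finset.add_sum_erase _ (fun γ => M * P.mass (b.set i γ) φ) (Finset.mem_univ s)]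
  have := Finset.sum_le_sum fun γ (hγ : γ ∈ Finset.univ.erase s) => h γ (Finset.ne_of_mem_erase hγ)
  linarith

theorem extendBy_extendedBy_full_iff {b : Partial n Γ} {σ : Fin n → Γ} {R : Finset (Fin n)}
    (hR : R ⊆ unknown b) (a : Fin n → Γ) :
    (extendBy b σ R).ExtendedBy (full a) ↔ b.ExtendedBy (full a) ∧ ∀ i ∈ R, a i = σ i := by
  constructor
  · refine fun h => ⟨(extendedBy_extendBy hR).trans h, fun i hi => ?_⟩
    have := h i (by simp [extendBy, hi])
    simpa [extendBy, hi, full] using this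
  · rintro ⟨h1, h2⟩ i hi
    by_cases hiR : i ∈ R
    · simp [extendBy, hiR, full, h2 i hiR]
    · rw [extendBy_of_notMem hiR] at hi ⊢
      exact h1 i hi

theorem removedWeight_eq (b : Partial n Γ) (σ : Fin n → Γ) {R : Finset (Fin n)}
    (hR : R ⊆ unknown b) : P.removedWeight b σ R =
      P.mass b (fun _ => 1) - P.mass (extendBy b σ R) (fun _ => 1) := by
  classical
  unfold removedWeight mass
  simp only [Finset.sum_filter, mul_one]
  rw [← Finset.sum_sub_distrib]
  refine Finset.sum_congr rfl fun a _ => ?_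
  simp only [extendBy_extendedBy_full_iff hR]
  have e1 : (∀ j ∈ R, a j = σ j) ↔ ¬ ∃ j ∈ R, a j ≠ σ j := by push Not; rfl
  simp only [e1]
  by_cases h1 : b.ExtendedBy (full a) <;> by_cases h2 : ∃ j ∈ R, a j ≠ σ j <;>
    simp only [h1, h2] <;> simp

/-- The realization that completes `b` by `σ`. -/
def completion (b : Partial n Γ) (σ : Fin n → Γ) : Fin n → Γ := fun i => (b i).getD (σ i)

theorem completion_of_mem_unknown {b : Partial n Γ} {i : Fin n} (hi : i ∈ unknown b)
    (σ : Fin n → Γ) : completion b σ i = σ i := by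
  simp [completion, mem_unknown.1 hi]

theorem eq_some_completion {b : Partial n Γ} {i : Fin n} (hi : i ∉ unknown b)
    (σ : Fin n → Γ) : b i = some (completion b σ i) := by
  obtain ⟨x, hx⟩ := Option.ne_none_iff_exists'.1 fun h => hi (mem_unknown.2 h)
  simp [completion, hx]

/-- A solution pays at least a quarter of the budget on the completion by worst-case states. -/
theorem budget_le {b : Partial n Γ} {σ : Fin n → Γ} {B : ℝ} (hb : P.g b ≠ P.Q)
    (hB : IsFindBudget (unknown b) (P.utilityAlong b σ) P.c B) {τ : DTree n Γ}
    (hτ : P.IsSolution τ) : B ≤ 4 * τ.pathCost P.c (completion b σ) := by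
  classical
  set x := τ.pathCost P.c (completion b σ) with hx
  set U := τ.prefixItems P.c (completion b σ) x
  have hUN : U ∩ unknown b ⊆ unknown b := Finset.inter_subset_right
  -- On the completion, `τ` learns only states that are in b or prescribed by σ, so the unknown
  -- items on its path have full value along σ.
  have hg : P.Q ≤ P.g (extendBy b σ (U ∩ unknown b)) := by
    refine DTree.SolvesFrom.le_of_prefixItems P.g_monotone P.c_pos (completion b σ) τ hτ hx.ge
      (fun i hi => absurd rfl hi) fun i hi => ?_
    by_cases hib : i ∈ unknown b
    · rw [completion_of_mem_unknown hib]
      simp [extendBy, hib, show i ∈ U from hi]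
    · rw [extendBy_of_notMem (by simp [hib]), eq_some_completion hib σ]
  have hV : P.utilityAlong b σ (U ∩ unknown b) = P.utilityAlong b σ (unknown b) := by
    rw [utilityAlong_unknown, utilityAlong, le_antisymm (P.g_le _) hg]
  have h1 := hB.le_four_mul (P.submodularOn_utilityAlong b σ) (P.utilityAlong_empty b σ) P.c_pos
    (P.utilityAlong_unknown_pos hb σ) hUN hV
  have h2 := Finset.sum_le_sum_of_subset_of_nonneg (Finset.inter_subset_left (s₁ := U)
    (s₂ := unknown b)) (fun i _ _ => (P.c_pos i).le)
  have h3 := τ.sum_prefixItems_le P.c_pos (completion b σ)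
    (x := x) (τ.pathCost_nonneg P.c_pos _)
  linarith

/-- The items that a tree tests within cost `t` on the completion of `b` remove all sample elements
on which the tree costs at most `t`. -/
theorem le_removedWeight_prefixItems (τ : DTree n Γ) (b : Partial n Γ) (σ : Fin n → Γ) {t : ℝ}
    (ht : t < τ.pathCost P.c (completion b σ)) :
    P.mass b (fun _ => 1) - P.mass b (fun a => if t < τ.pathCost P.c a then 1 else 0) ≤
      P.removedWeight b σ (τ.prefixItems P.c (completion b σ) t ∩ unknown b) := by
  classical
  unfold removedWeight mass
  simp only [Finset.sum_filter, mul_one]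
  rw [← Finset.sum_sub_distrib]
  refine Finset.sum_le_sum fun a _ => ?_
  have hw : (0 : ℝ) ≤ P.w a := Nat.cast_nonneg _
  by_cases h1 : b.ExtendedBy (full a)
  · by_cases h2 : t < τ.pathCost P.c a
    · simp only [h1, h2, if_true, mul_one, sub_self]
      split_ifs <;> simp
    · obtain ⟨i, hi, hne⟩ := τ.exists_ne_of_pathCost_lt P.c_pos a _ (not_lt.1 h2) ht
      have hib : i ∈ unknown b := by
        by_contra hib
        have h3 := eq_some_completion hib σ
        have := h1 i (by rw [h3]; simp)
        rw [h3] at this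
        exact hne (by simpa [full] using this)
      rw [completion_of_mem_unknown hib] at hne
      have : ∃ i ∈ τ.prefixItems P.c (completion b σ) t ∩ unknown b, a i ≠ σ i :=
        ⟨i, Finset.mem_inter.2 ⟨hi, hib⟩, hne⟩
      rw [if_pos h1, if_pos h1, if_neg h2, if_pos ⟨h1, this⟩]
      simp
  · simp [h1]

end Problem

/-! ### The backbone of a call. -/

namespace Problem

variable {n : ℕ} {Γ : Type*} (P : Problem n Γ)

/-- The invariants of the two loops of a call on `b₀`: `R` is the set of items on the backbone so
far, `b` the present extension of `b₀`, `I` the set of available items, and `s` the money spent. -/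
structure Backbone (b₀ : Partial n Γ) (σ : Fin n → Γ) (B : ℝ) (b : Partial n Γ)
    (R I : Finset (Fin n)) (s : ℝ) : Prop where
  goal : P.g b₀ ≠ P.Q
  worst : ∀ i, b₀ i = none → IsWorstState P.g b₀ i (σ i)
  budget : IsFindBudget (unknown b₀) (P.utilityAlong b₀ σ) P.c B
  eq_extendBy : b = extendBy b₀ σ R
  subset : R ⊆ unknown b₀
  available_subset : I ⊆ unknown b₀
  disjoint : Disjoint R I
  cover : (unknown b₀).filter (fun i => P.c i ≤ B) ⊆ R ∪ I
  cost_le : ∀ i ∈ I, P.c i ≤ B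
  spent_nonneg : 0 ≤ s
  spent_le : s ≤ 2 * B

namespace Backbone

variable {P} {b₀ b : Partial n Γ} {σ : Fin n → Γ} {B s : ℝ} {R I : Finset (Fin n)}

theorem budget_pos (h : P.Backbone b₀ σ B b R I s) : 0 < B :=
  h.budget.pos (P.utilityAlong_empty b₀ σ) P.c_pos (P.utilityAlong_unknown_pos h.goal σ)

theorem eq_none (h : P.Backbone b₀ σ B b R I s) {i : Fin n} (hi : i ∈ I) : b i = none := by
  rw [h.eq_extendBy, extendBy_of_notMem fun hR => Finset.disjoint_left.1 h.disjoint hR hi]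
  exact mem_unknown.1 (h.available_subset hi)

theorem step (h : P.Backbone b₀ σ B b R I s) {i : Fin n} (hi : i ∈ I) (hs : s < B) :
    P.Backbone b₀ σ B (b.set i (σ i)) (insert i R) (I.erase i) (s + P.c i) where
  goal := h.goal
  worst := h.worst
  budget := h.budget
  eq_extendBy := by rw [extendBy_insert, h.eq_extendBy]
  subset := Finset.insert_subset (h.available_subset hi) h.subset
  available_subset := (Finset.erase_subset _ _).trans h.available_subset
  disjoint := by
    rw [Finset.disjoint_insert_left]
    exact ⟨Finset.notMem_erase _ _, h.disjoint.mono_right (Finset.erase_subset _ _)⟩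
  cover := fun j hj => by
    have := h.cover hj
    simp only [Finset.mem_union, Finset.mem_insert, Finset.mem_erase] at this ⊢
    tauto
  cost_le := fun j hj => h.cost_le j (Finset.mem_of_mem_erase hj)
  spent_nonneg := add_nonneg h.spent_nonneg (P.c_pos i).le
  spent_le := by linarith [h.cost_le i hi]

theorem reset (h : P.Backbone b₀ σ B b R I s) : P.Backbone b₀ σ B b R I 0 where
  __ := h
  spent_nonneg := le_rfl
  spent_le := by linarith [h.budget_pos]

theorem start {b₀ : Partial n Γ} {σ : Fin n → Γ} {B : ℝ} (goal : P.g b₀ ≠ P.Q)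
    (worst : ∀ i, b₀ i = none → IsWorstState P.g b₀ i (σ i))
    (budget : IsFindBudget (unknown b₀) (P.utilityAlong b₀ σ) P.c B) :
    P.Backbone b₀ σ B b₀ ∅ ((unknown b₀).filter (fun i => P.c i ≤ B)) 0 where
  goal := goal
  worst := worst
  budget := budget
  eq_extendBy := (extendBy_empty b₀ σ).symm
  subset := Finset.empty_subset _
  available_subset := Finset.filter_subset _ _
  disjoint := Finset.disjoint_empty_left _
  cover := by rw [Finset.empty_union]
  cost_le := fun i hi => (Finset.mem_filter.1 hi).2
  spent_nonneg := le_rfl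
  spent_le := by
    linarith [budget.pos (P.utilityAlong_empty b₀ σ) P.c_pos (P.utilityAlong_unknown_pos goal σ)]

theorem extendedBy (h : P.Backbone b₀ σ B b R I s) : b₀.ExtendedBy b := by
  rw [h.eq_extendBy]
  exact extendedBy_extendBy h.subset

/-- A recursive call off the backbone is on a partial realization of larger utility. -/
theorem progress_off (h : P.Backbone b₀ σ B b R I s) {i : Fin n} (hi : i ∈ I) {γ : Γ}
    (hγ : γ ≠ σ i) :
    (P.g b₀ : ℝ) + P.rho * ((P.Q : ℝ) - P.g b₀) ≤ P.g (b.set i γ) := by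
  have hi0 := mem_unknown.1 (h.available_subset hi)
  have h1 := P.rho_mul_le_gain (lt_of_le_of_ne (P.g_le b₀) h.goal) hi0 (h.worst i hi0) hγ
  -- The states σ are worst at b₀ and need not be so at b; the gain at b₀ carries over to b by
  -- monotonicity.
  have h2 : (b₀.set i γ).ExtendedBy (b.set i γ) := by
    rw [Partial.set_extendedBy_iff hi0]
    exact ⟨h.extendedBy.trans (Partial.extendedBy_set (h.eq_none hi) γ), by simp [Partial.set]⟩
  have h3 : (P.g (b₀.set i γ) : ℝ) ≤ P.g (b.set i γ) := by
    exact_mod_cast P.g_monotone.le_of_extendedBy h2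
  unfold gain at h1
  linarith

/-- The utility gained in the second loop, relative to the sets within the budget. -/
def Spends (P : Problem n Γ) (b₀ : Partial n Γ) (σ : Fin n → Γ) (B : ℝ) (R : Finset (Fin n))
    (s : ℝ) : Prop :=
  ∀ V ⊆ (unknown b₀).filter (fun i => P.c i ≤ B), ∑ i ∈ V, P.c i ≤ B →
    min B s * P.utilityAlong b₀ σ V ≤ 2 * B * P.utilityAlong b₀ σ R

theorem spends_zero (h : P.Backbone b₀ σ B b R I s) : Spends P b₀ σ B R 0 := by
  intro V _ _
  have hB := h.budget_pos
  have := (P.submodularOn_utilityAlong b₀ σ).le_of_subset (Finset.empty_subset R) h.subset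
  rw [utilityAlong_empty] at this
  rw [min_eq_right hB.le, zero_mul]
  positivity

theorem spends_step (h : P.Backbone b₀ σ B b R I s) {i : Fin n} (hi : i ∈ I)
    (hmax : ∀ j ∈ I, gain P.g b j (σ j) / P.c j ≤ gain P.g b i (σ i) / P.c i)
    (hs : Spends P b₀ σ B R s) : Spends P b₀ σ B (insert i R) (s + P.c i) := by
  intro V hV hVB
  have hB := h.budget_pos
  have hc := P.c_pos i
  have hf := P.submodularOn_utilityAlong b₀ σ
  have h1 := hs V hV hVB
  have hg : IsGreedyChoice (P.utilityAlong b₀ σ) P.c R I i := by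
    refine ⟨hi, fun j hj => ?_⟩
    rw [utilityAlong_insert_sub, utilityAlong_insert_sub, ← h.eq_extendBy]
    exact hmax j hj
  have h2 := hf.greedy_gain P.c_pos h.subset h.available_subset (hV.trans h.cover) hg
  have h3 := hf.mono R h.subset i (h.available_subset hi)
  have h4 := hf.le_of_subset (Finset.empty_subset V) (hV.trans (Finset.filter_subset _ _))
  rw [utilityAlong_empty] at h4
  generalize P.utilityAlong b₀ σ V = v at h1 h2 h4 ⊢
  generalize P.utilityAlong b₀ σ R = r at h1 h2 h3 ⊢
  generalize P.utilityAlong b₀ σ (insert i R) = r' at h2 h3 ⊢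
  -- Until R is worth half of V, every unit of cost gains at least v/(2B). Items from the first loop
  -- belong to R and can only help.
  by_cases h5 : v ≤ 2 * r
  · calc min B (s + P.c i) * v ≤ B * v := mul_le_mul_of_nonneg_right (min_le_left _ _) h4
      _ ≤ B * (2 * r') := mul_le_mul_of_nonneg_left (by linarith) hB.le
      _ = _ := by ring
  · push Not at h5
    have h6 : min B (s + P.c i) ≤ min B s + P.c i := by
      rw [min_add]
      exact le_min ((min_le_left _ _).trans (by linarith)) (min_le_right _ _)
    have h7 := mul_le_mul_of_nonneg_right h6 h4
    have h8 : (∑ j ∈ V, P.c j) * (r' - r) ≤ B * (r' - r) :=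
      mul_le_mul_of_nonneg_right hVB (by linarith)
    have h9 : P.c i * (v / 2) ≤ P.c i * (v - r) := mul_le_mul_of_nonneg_left (by linarith) hc.le
    linarith

/-- The recursive call at the end of the backbone is on a partial realization of larger utility. -/
theorem progress_end (h : P.Backbone b₀ σ B b R I s) (hs : Spends P b₀ σ B R s)
    (hend : B ≤ s ∨ I = ∅) :
    (P.g b₀ : ℝ) + alpha / 2 * ((P.Q : ℝ) - P.g b₀) ≤ P.g b := by
  obtain ⟨V, hV, hVB, hα⟩ := h.budget.exists_set
  have hB := h.budget_pos
  have hf := P.submodularOn_utilityAlong b₀ σ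
  have hV' : V ⊆ (unknown b₀).filter (fun i => P.c i ≤ B) := by convert hV
  have h0 := hf.le_of_subset (Finset.empty_subset R) h.subset
  rw [utilityAlong_empty] at h0
  have key : P.utilityAlong b₀ σ V ≤ 2 * P.utilityAlong b₀ σ R := by
    -- If the items run out before the money, the backbone contains every affordable item, and so
    -- all of V.
    rcases hend with hBs | rfl
    · have := hs V hV' hVB
      rw [min_eq_left hBs] at this
      exact le_of_mul_le_mul_left (by linarith) hB
    · have hVR := hV'.trans h.cover
      rw [Finset.union_empty] at hVR
      have := hf.le_of_subset hVR h.subset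
      linarith
  rw [utilityAlong_unknown] at hα
  have : P.utilityAlong b₀ σ R = (P.g b : ℝ) - P.g b₀ := by
    rw [utilityAlong, ← h.eq_extendBy]
  linarith

/-- The weight removed by a greedy choice in the first loop, compared with a tree `τ`. -/
theorem removed_ge (h : P.Backbone b₀ σ B b R I s) {i : Fin n}
    (hi : IsGreedyChoice (P.removedWeight b₀ σ) P.c R I i) (τ : DTree n Γ) {t : ℝ} (ht0 : 0 ≤ t)
    (ht : t < τ.pathCost P.c (completion b₀ σ)) (htB : t ≤ B) :
    P.c i * (P.mass b (fun _ => 1) -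
        P.mass b₀ (fun a => if t < τ.pathCost P.c a then 1 else 0)) ≤
      t * (P.mass b (fun _ => 1) - P.mass (b.set i (σ i)) (fun _ => 1)) := by
  have hf := P.submodularOn_removedWeight b₀ σ (unknown b₀)
  set V := τ.prefixItems P.c (completion b₀ σ) t ∩ unknown b₀
  have hVt : ∑ j ∈ V, P.c j ≤ t :=
    (Finset.sum_le_sum_of_subset_of_nonneg Finset.inter_subset_left
      (fun i _ _ => (P.c_pos i).le)).trans (τ.sum_prefixItems_le P.c_pos _ ht0)
  -- Each item of V costs at most t ≤ B, so it was available to the greedy choice or is already on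
  -- the backbone.
  have hVI : V ⊆ R ∪ I := fun j hj => by
    refine h.cover (Finset.mem_filter.2 ⟨(Finset.mem_inter.1 hj).2, ?_⟩)
    have := Finset.single_le_sum (f := P.c) (fun j _ => (P.c_pos j).le) hj
    linarith
  have h1 := hf.greedy_gain P.c_pos h.subset h.available_subset hVI hi
  have h2 := hf.mono R h.subset i (h.available_subset hi.1)
  have h3 := P.le_removedWeight_prefixItems τ b₀ σ ht
  change _ ≤ P.removedWeight b₀ σ V at h3
  have h4 := P.removedWeight_eq b₀ σ h.subset
  have h5 := P.removedWeight_eq b₀ σ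
    (Finset.insert_subset (h.available_subset hi.1) h.subset)
  rw [extendBy_insert, ← h.eq_extendBy] at h5
  rw [← h.eq_extendBy] at h4
  have h6 : P.c i * (P.mass b (fun _ => 1) -
        P.mass b₀ (fun a => if t < τ.pathCost P.c a then 1 else 0)) ≤
      P.c i * (P.removedWeight b₀ σ V - P.removedWeight b₀ σ R) :=
    mul_le_mul_of_nonneg_left (by linarith) (P.c_pos i).le
  have h7 := mul_le_mul_of_nonneg_right hVt (sub_nonneg.2 h2)
  have h8 : P.removedWeight b₀ σ (insert i R) - P.removedWeight b₀ σ R =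
    P.mass b (fun _ => 1) - P.mass (b.set i (σ i)) (fun _ => 1) := by linarith
  rw [← h8]
  linarith

end Backbone

/-! ### The cost induction. -/

/-- The factor by which the cost of a call on `b` may exceed the cost of a solution. -/
noncomputable def callFactor (b : Partial n Γ) : ℝ :=
  44 * recursionBound (P.rho * alpha / 2) (P.Q - P.g b)

/-- A bound on the factor of the calls made by a call on `b`. -/
noncomputable def subcallFactor (b : Partial n Γ) : ℝ :=
  44 * (Real.log ((P.Q - P.g b : ℕ) : ℝ) / (P.rho * alpha / 2))

theorem callFactor_eq {b : Partial n Γ} (hb : P.g b ≠ P.Q) :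
    P.callFactor b = 44 + P.subcallFactor b := by
  have := lt_of_le_of_ne (P.g_le b) hb
  rw [callFactor, subcallFactor, recursionBound, if_neg (by omega)]
  ring

theorem callFactor_le (hρ : 0 < P.rho) {b d : Partial n Γ} (hb : P.g b ≠ P.Q)
    (h : (P.g b : ℝ) + P.rho * alpha / 2 * ((P.Q : ℝ) - P.g b) ≤ P.g d) :
    P.callFactor d ≤ P.subcallFactor b := by
  have h1 := lt_of_le_of_ne (P.g_le b) hb
  refine mul_le_mul_of_nonneg_left (recursionBound_le ?_ (by omega) ?_) (by norm_num)
  · have := alpha_pos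
    positivity
  · rw [Nat.cast_sub (P.g_le d), Nat.cast_sub h1.le]
    linarith

theorem callFactor_le_of_rho (hρ : 0 < P.rho) {b d : Partial n Γ} (hb : P.g b ≠ P.Q)
    (h : (P.g b : ℝ) + P.rho * ((P.Q : ℝ) - P.g b) ≤ P.g d) :
    P.callFactor d ≤ P.subcallFactor b := by
  refine P.callFactor_le hρ hb (le_trans ?_ h)
  have h1 : (P.g b : ℝ) ≤ P.Q := by exact_mod_cast P.g_le b
  have : P.rho * alpha / 2 * ((P.Q : ℝ) - P.g b) ≤ P.rho * ((P.Q : ℝ) - P.g b) := by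
    refine mul_le_mul_of_nonneg_right ?_ (by linarith)
    have := mul_le_mul_of_nonneg_left alpha_le hρ.le
    linarith
  linarith

theorem callFactor_le_of_alpha (hρ : 0 < P.rho) {b d : Partial n Γ} (hb : P.g b ≠ P.Q)
    (h : (P.g b : ℝ) + alpha / 2 * ((P.Q : ℝ) - P.g b) ≤ P.g d) :
    P.callFactor d ≤ P.subcallFactor b := by
  refine P.callFactor_le hρ hb (le_trans ?_ h)
  have h1 : (P.g b : ℝ) ≤ P.Q := by exact_mod_cast P.g_le b
  have : P.rho * alpha / 2 * ((P.Q : ℝ) - P.g b) ≤ alpha / 2 * ((P.Q : ℝ) - P.g b) := by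
    refine mul_le_mul_of_nonneg_right ?_ (by linarith)
    have := mul_le_mul_of_nonneg_right P.rho_le_one alpha_pos.le
    linarith
  linarith

/-- The cost bounds at a control state, relative to a tree `τ`. -/
def CostBound (τ : DTree n Γ) (s : Control n Γ) (T : DTree n Γ) : Prop :=
  match s with
  | .call b => P.mass b (T.pathCost P.c) ≤ P.callFactor b * P.mass b (τ.pathCost P.c)
  | .first b₀ σ B b R I s => P.Backbone b₀ σ B b R I s →
      P.mass b (T.pathCost P.c) ≤ (4 * B - s) * P.mass b (fun _ => 1) +
        P.subcallFactor b₀ * P.mass b (τ.pathCost P.c) ∧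
      ∀ x, 0 ≤ x → P.mass b (T.pathCost P.c) ≤
        12 * (P.mass b (fun _ => 1) / 2 * x + P.mass b₀ (fun a => max (τ.pathCost P.c a - x) 0)) +
        32 * P.mass b₀ (τ.pathCost P.c) + 2 * s * P.mass b (fun _ => 1) +
        P.subcallFactor b₀ * P.mass b (τ.pathCost P.c)
  | .second σ B b I s => ∀ b₀ R, P.Backbone b₀ σ B b R I s → Backbone.Spends P b₀ σ B R s →
      P.mass b (T.pathCost P.c) ≤ (2 * B - s) * P.mass b (fun _ => 1) +
        P.subcallFactor b₀ * P.mass b (τ.pathCost P.c)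

/-- The cost of a backbone node. -/
theorem Backbone.mass_node_le [Finite Γ] {P : Problem n Γ} (hρ : 0 < P.rho) {τ : DTree n Γ}
    {b₀ b : Partial n Γ} {σ : Fin n → Γ} {B s X : ℝ} {R I : Finset (Fin n)}
    (h : P.Backbone b₀ σ B b R I s) {i : Fin n} (hi : i ∈ I) {child : Γ → DTree n Γ}
    (hrec : ∀ γ, γ ≠ σ i → P.CostBound τ (.call (b.set i γ)) (child γ))
    (hnext : P.mass (b.set i (σ i)) ((child (σ i)).pathCost P.c) ≤
      X + P.subcallFactor b₀ * P.mass (b.set i (σ i)) (τ.pathCost P.c)) :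
    P.mass b ((DTree.node i child).pathCost P.c) ≤
      P.c i * P.mass b (fun _ => 1) + X + P.subcallFactor b₀ * P.mass b (τ.pathCost P.c) :=
  P.mass_pathCost_node_le (h.eq_none hi) (σ i) (fun γ hγ => (hrec γ hγ).trans
    (mul_le_mul_of_nonneg_right (P.callFactor_le_of_rho hρ h.goal (h.progress_off hi hγ))
      (P.mass_nonneg (τ.pathCost_nonneg P.c_pos)))) hnext

/-- Once half of the remaining weight is expensive for `τ`, the remaining budget can be paid. -/
theorem mass_le_of_expensive (τ : DTree n Γ) {b₀ b : Partial n Γ} {B : ℝ} (hB : 0 < B)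
    (h : P.mass b (fun _ => 1) / 2 ≤
      P.mass b₀ (fun a => if B / 4 ≤ τ.pathCost P.c a then 1 else 0)) :
    4 * B * P.mass b (fun _ => 1) ≤ 32 * P.mass b₀ (τ.pathCost P.c) := by
  -- Weight y/2 at cost at least B/4 contributes By/8, and 32 times this is 4By.
  have h1 : P.mass b₀ (fun a => B / 4 * if B / 4 ≤ τ.pathCost P.c a then 1 else 0) ≤
      P.mass b₀ (τ.pathCost P.c) := by
    refine P.mass_mono fun a => ?_
    have := τ.pathCost_nonneg P.c_pos a
    split_ifs with h
    · simpa using h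
    · simpa using this
  rw [mass_const_mul] at h1
  have := mul_le_mul_of_nonneg_left h hB.le
  linarith

theorem Builds.costBound [Finite Γ] (hρ : 0 < P.rho) {τ : DTree n Γ} (hτ : P.IsSolution τ)
    {s : Control n Γ} {T : DTree n Γ} (h : P.Builds s T) : P.CostBound τ s T := by
  have hpos := τ.pathCost_nonneg P.c_pos
  have hone : ∀ b : Partial n Γ, 0 ≤ P.mass b (fun _ => 1) := fun b =>
    P.mass_nonneg fun _ => zero_le_one
  induction h with
  | done b hb =>
    simp [CostBound, callFactor, recursionBound, hb, mass, DTree.pathCost]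
  | start b σ B T hb hσ hB hT ih =>
    -- At x = 0 and s = 0 the potential is the mass of κ, so the total factor is 12 + 32 = 44.
    have h1 := (ih (by convert Backbone.start hb hσ hB)).2 0 le_rfl
    have h2 : P.mass b (fun a => max (τ.pathCost P.c a - 0) 0) = P.mass b (τ.pathCost P.c) := by
      congr 1
      funext a
      rw [sub_zero, max_eq_left (hpos a)]
    rw [h2] at h1
    rw [CostBound, P.callFactor_eq hb]
    linarith
  | firstStep b₀ σ B b R I s i child hs hi hrec hnext ih1 ih2 =>
    intro hbb
    obtain ⟨ha, hx⟩ := ih2 (hbb.step hi.1 hs)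
    have hB := hbb.budget_pos
    have hcB := hbb.cost_le i hi.1
    have hmass := P.mass_set_le (hbb.eq_none hi.1) (σ i) (φ := fun _ => 1) fun _ => zero_le_one
    have hA : P.mass b ((DTree.node i child).pathCost P.c) ≤
        (4 * B - s) * P.mass b (fun _ => 1) +
        P.subcallFactor b₀ * P.mass b (τ.pathCost P.c) := by
      have h1 := hbb.mass_node_le hρ hi.1 ih1 ha
      have := mul_le_mul_of_nonneg_left hmass (by linarith : 0 ≤ 4 * B - (s + P.c i))
      linarith
    refine ⟨hA, fun u hu => ?_⟩
    have hs0 := hbb.spent_nonneg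
    rcases le_or_gt (P.mass b (fun _ => 1) / 2)
      (P.mass b₀ (fun a => if B / 4 ≤ τ.pathCost P.c a then 1 else 0)) with hexp | hcheap
    · have h1 := P.mass_le_of_expensive τ hB hexp
      have h2 : 0 ≤ P.mass b₀ (fun a => max (τ.pathCost P.c a - u) 0) :=
        P.mass_nonneg fun a => le_max_right _ _
      have h3 := mul_nonneg (hone b) hu
      have h4 := mul_nonneg hs0 (hone b)
      linarith
    · obtain ⟨t, ht0, htB, hty, hmin⟩ := exists_threshold _ (fun a => Nat.cast_nonneg (P.w a))
        (by linarith : 0 < B / 4) hcheap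
      -- It suffices to prove the bound at the minimizer t, which lets the induction hypothesis be
      -- used at the same t.
      refine le_trans ?_ (add_le_add_left (add_le_add_left (add_le_add_left
        (mul_le_mul_of_nonneg_left (hmin u hu) (by norm_num)) _) _) _)
      -- From t < B/4 it follows that t is less than the cost of `τ` on the completion, as
      -- `removed_ge` requires.
      have hbud := P.budget_le hbb.goal hbb.budget hτ
      have h1 := hbb.removed_ge hi τ ht0 (by linarith) (by linarith)
      have h2 := hx t ht0
      have h3 : P.mass b ((DTree.node i child).pathCost P.c) ≤ _ :=
        hbb.mass_node_le hρ hi.1 ih1 h2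
      -- With y' the weight after the step, c_i y/2 ≤ t(y - y'). So 12(y/2)t drops by 6t(y - y') ≥
      -- 3c_i y: one part pays for the node, two for the growth of 2sy.
      have h4 : P.c i * (P.mass b (fun _ => 1) / 2) ≤ P.c i * (P.mass b (fun _ => 1) -
          P.mass b₀ (fun a => if t < τ.pathCost P.c a then 1 else 0)) := by
        refine mul_le_mul_of_nonneg_left ?_ (P.c_pos i).le
        change P.mass b₀ (fun a => if t < τ.pathCost P.c a then 1 else 0) ≤ _ at hty
        linarith
      have h5 := mul_le_mul_of_nonneg_left hmass (by linarith [P.c_pos i] : 0 ≤ s + P.c i)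
      change _ ≤ 12 * (P.mass b (fun _ => 1) / 2 * t +
        P.mass b₀ (fun a => max (τ.pathCost P.c a - t) 0)) + _ + _ + _
      linarith
  | firstExit b₀ σ B b R I s T hs hT ih =>
    intro hbb
    have hB := hbb.budget_pos
    have h1 := ih b₀ R hbb.reset hbb.spends_zero
    have hs0 := hbb.spent_nonneg
    -- The second loop costs at most 2By. This is at most 2sy as B ≤ s, and at most (4B - s)y as s ≤
    -- 2B.
    have h2 := mul_le_mul_of_nonneg_right hs (hone b)
    have h3 := mul_le_mul_of_nonneg_right hbb.spent_le (hone b)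
    refine ⟨by linarith, fun u hu => ?_⟩
    have h4 : 0 ≤ P.mass b₀ (fun a => max (τ.pathCost P.c a - u) 0) :=
      P.mass_nonneg fun a => le_max_right _ _
    have h5 := mul_nonneg (hone b) hu
    have h6 := P.mass_nonneg (b := b₀) hpos
    linarith
  | secondStep σ B b I s i child hs hi hmax hrec hnext ih1 ih2 =>
    intro b₀ R hbb hsp
    have h1 := ih2 b₀ (insert i R) (hbb.step hi hs) (hbb.spends_step hi hmax hsp)
    have h2 := hbb.mass_node_le hρ hi ih1 h1
    have hcB := hbb.cost_le i hi
    have hmass := P.mass_set_le (hbb.eq_none hi) (σ i) (φ := fun _ => 1) fun _ => zero_le_one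
    have := mul_le_mul_of_nonneg_left hmass (by linarith : 0 ≤ 2 * B - (s + P.c i))
    linarith
  | secondExit σ B b I s T hs hT ih =>
    intro b₀ R hbb hsp
    have h1 := mul_le_mul_of_nonneg_right
      (P.callFactor_le_of_alpha hρ hbb.goal (hbb.progress_end hsp hs)) (P.mass_nonneg hpos (b := b))
    have h2 := mul_nonneg (sub_nonneg.2 hbb.spent_le) (hone b)
    rw [CostBound] at ih
    linarith

theorem expectedCost_eq (T : DTree n Γ) : P.expectedCost T =
    P.mass (emptyPartial n Γ) (T.pathCost P.c) / P.totalWeight := by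
  classical
  unfold expectedCost mass
  rw [Finset.filter_true_of_mem fun a _ i hi => absurd rfl hi, Finset.sum_div]
  exact Finset.sum_congr rfl fun a _ => by ring

theorem expectedCost_nonneg (T : DTree n Γ) : 0 ≤ P.expectedCost T := by
  rw [expectedCost_eq]
  exact div_nonneg (P.mass_nonneg (T.pathCost_nonneg P.c_pos)) (Nat.cast_nonneg _)

theorem expectedCost_le [Finite Γ] (hρ : 0 < P.rho) {T τ : DTree n Γ} (hT : P.IsMixedGreedyTree T)
    (hτ : P.IsSolution τ) :
    P.expectedCost T ≤
      44 * (1 + Real.log P.Q / (P.rho * alpha / 2)) * P.expectedCost τ := by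
  have h1 : P.mass _ _ ≤ _ * P.mass _ _ := hT.costBound P hρ hτ
  have hα := alpha_pos
  have h2 : P.callFactor (emptyPartial n Γ) ≤
      44 * (1 + Real.log P.Q / (P.rho * alpha / 2)) := by
    refine mul_le_mul_of_nonneg_left ?_ (by norm_num)
    have hQ : (1 : ℝ) ≤ P.Q := by exact_mod_cast P.Q_pos
    unfold recursionBound
    split_ifs with h0
    · have := Real.log_nonneg hQ
      positivity
    · gcongr
      exact Nat.sub_le _ _
  rw [expectedCost_eq, expectedCost_eq, ← mul_div_assoc]
  refine div_le_div_of_nonneg_right (h1.trans ?_) (Nat.cast_nonneg _)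
  exact mul_le_mul_of_nonneg_right h2 (P.mass_nonneg (τ.pathCost_nonneg P.c_pos))

end Problem
end ScenarioSC

theorem theorem1 :
    ∃ K : ℝ, 0 < K ∧
      ∀ (n : ℕ) (Γ : Type*) [Finite Γ] (P : ScenarioSC.Problem n Γ),
        (∃ T : ScenarioSC.DTree n Γ, P.IsMixedGreedyTree T) ∧
        ∀ T : ScenarioSC.DTree n Γ, P.IsMixedGreedyTree T →
          P.IsSolution T ∧
          (0 < P.rho → ∀ τ : ScenarioSC.DTree n Γ, P.IsSolution τ →
            (2 ≤ P.Q →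
              P.expectedCost T ≤ K * (1 / P.rho * Real.log P.Q) * P.expectedCost τ) ∧
            (P.Q = 1 → P.expectedCost T ≤ K * P.expectedCost τ)) := by
  have hα := ScenarioSC.alpha_pos
  refine ⟨44 * (2 + 2 / ScenarioSC.alpha), by positivity, fun n Γ _ P =>
    ⟨P.exists_builds_call _ _ rfl, fun T hT => ⟨hT.solvesControl P, fun hρ τ hτ => ?_⟩⟩⟩
  have h := P.expectedCost_le hρ hT hτ
  have hτ0 := P.expectedCost_nonneg τ
  refine ⟨fun hQ => h.trans (mul_le_mul_of_nonneg_right ?_ hτ0), fun hQ => h.trans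
    (mul_le_mul_of_nonneg_right ?_ hτ0)⟩
  -- Since ρ ≤ 1 and log Q ≥ log 2 > 1/2, the additive 1 is at most 2(1/ρ) log Q; this is the 2 in 2
  -- + 2/α.
  · have hlog : 1 / 2 ≤ Real.log P.Q := by
      have h2 : (2 : ℝ) ≤ P.Q := by exact_mod_cast hQ
      have := Real.log_le_log (by norm_num) h2
      linarith [Real.log_two_gt_d9]
    have h1 : 1 ≤ 1 / P.rho := by rw [le_div_iff₀ hρ, one_mul]; exact P.rho_le_one
    have h2 : 1 * (1 / 2) ≤ 1 / P.rho * Real.log P.Q :=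
      mul_le_mul h1 hlog (by norm_num) (by positivity)
    have h3 : Real.log P.Q / (P.rho * ScenarioSC.alpha / 2) =
        2 / ScenarioSC.alpha * (1 / P.rho * Real.log P.Q) := by
      field_simp
    rw [h3]
    linarith
  · rw [hQ, Nat.cast_one, Real.log_one, zero_div]
    have : 0 ≤ 2 / ScenarioSC.alpha := by positivity
    linarith
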